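/- Let $\Omega\subset\mathbb R^3$ be a bounded domain (nonempty, open, connected) with boundary of class $C^1$, let $a\in C^0(\partial\Omega,\mathbb R)$ and $a_1,a_2,a_3\in C^1(\overline\Omega,\mathbb R)$. Let $e_1,e_2,e_3$ be the imaginary units of the quaternions $\mathbb H$, and let $T=\sum_{\ell=1}^3 e_\ell a_\ell\partial_{x_\ell}$ act in the sense of distributions on $V=L^2(\Omega,\mathbb H)$, with domain $\operatorname{dom}(T)=\{v\in V: Tv\in V\}$. Let $C_{\partial\Omega}>0$ and $C_P>0$ be constants such that for all $u\in H^1(\Omega,\mathbb R)$ $$\|u\|_{H^{1/2}(\partial\Omega)}\le C_{\partial\Omega}\|u\|_{H^1(\Omega)},\qquad \Big\|u-|\Omega|^{-1}\int_\Omega u\,dx\Big\|_{L^2(\Omega)}\le C_P\|\nabla u\|_{L^2(\Omega)},$$ where $\|g\|_{H^{1/2}(\partial\Omega)}^2=\int_{\partial\Omega}|g|^2dS+\iint_{\partial\Omega\times\partial\Omega}\frac{|g(x)-g(y)|^2}{|x-y|^3}dS(x)\,dS(y)$ (applied to the trace of $u$). Put $$C_T=\min_{\ell}\inf_\Omega a_\ell^2,\qquad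 C_T'=\sum_{i,\ell=1}^3\|a_\ell\partial_{x_\ell}a_i\|_\infty,\qquad K_{a,\Omega}=C_{\partial\Omega}^2\|a\|_\infty ,$$ and assume $C_T-C_T'C_P-K_{a,\Omega}(1+C_P^2)>0$ and $C_T>0$. Let $\mathcal H=\{u\in H^1(\Omega,\mathbb H):\int_\Omega u\,dx=0\}$. For $s\in\mathbb H$ the operator $Q_s(T)=T^2-2\operatorname{Re}(s)T+|s|^2$ with the Robin condition $au+\sum_\ell a_\ell^2n_\ell\partial_{x_\ell}u=0$ on $\partial\Omega$ is understood weakly: for $F\in V$, $Q_s(T)u=F$ means that $u\in\mathcal H$ and for all $v\in\mathcal H$ $$\sum_\ell\int_\Omega \overline{a_\ell\partial_{x_\ell}u}\,a_\ell\partial_{x_\ell}v+\tfrac12\sum_\ell\int_\Omega\overline{\partial_{x_\ell}u}\,\partial_{x_\ell}(a_\ell^2)\,v+\int_\Omega\overline{\operatorname{Vect}(Q_s(T))u}\,v+\int_{\partial\Omega}a\,\overline u\,v\,dS+|s|^2\int_\Omega\overline u\,v=\int_\Omega\overline F\,v ,$$ where $\operatorname{Vect}(Q_s(T))u=\sum_{\ell\ne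 i}e_\ell e_i\,a_\ell(\partial_{x_\ell}a_i)\,\partial_{x_i}u-2\operatorname{Re}(s)\,Tu$. The quaternion $s$ belongs to the $S$-resolvent set $\rho_S(T)$ if this problem has, for every $F\in V$, exactly one solution $u=:Q_s(T)^{-1}F$ and $Q_s(T)^{-1}$ is a bounded right linear operator on $V$; then $$S_L^{-1}(s,T)=Q_s(T)^{-1}\overline s-TQ_s(T)^{-1},\qquad S_R^{-1}(s,T)=-(T-\overline s)Q_s(T)^{-1}.$$ Then every $s\in\mathbb H\setminus\{0\}$ with $\operatorname{Re}(s)=0$ belongs to $\rho_S(T)$, and $Q_s(T)^{-1}$ maps $V$ into $\operatorname{dom}(T)$. Moreover, for every $I\in\mathbb H$ with $\operatorname{Re}(I)=0$ and $|I|=1$, every $\alpha\in(0,1)$ and every $v\in\operatorname{dom}(T)$, the integrals $$\frac1{2\pi}\int_{-I\mathbb R}S_L^{-1}(s,T)\,ds_I\,s^{\alpha-1}Tv,\qquad \frac1{2\pi}\int_{-I\mathbb R}s^{\alpha-1}\,ds_I\,S_R^{-1}(s,T)Tv,\qquad ds_I=ds/I,$$ converge absolutely in $L^2(\Omega,\mathbb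 H)$. -/

import Mathlib

open MeasureTheory Filter Topology
open scoped ENNReal Quaternion

noncomputable section

namespace RobinFractional

/-- Euclidean three-space. -/
abbrev E3 : Type := EuclideanSpace ℝ (Fin 3)

/-- The partial derivative `∂_{x_i} f (x)`. -/
def pd {F : Type*} [NormedAddCommGroup F] [NormedSpace ℝ F] (i : Fin 3) (f : E3 → F) (x : E3) : F :=
  fderiv ℝ f x (EuclideanSpace.single i 1)

/-! ### The domain and the coefficients -/

/-- A bounded domain (nonempty, open, connected set) of `ℝ³` with boundary of class `C¹`: near each
boundary point, in suitable orthonormal coordinates, it is the region above the graph of a `C¹`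
function of two variables. -/
structure IsBoundedC1Domain (Ω : Set E3) : Prop where
  isOpen : IsOpen Ω
  isConnected : IsConnected Ω
  isBounded : Bornology.IsBounded Ω
  boundary : ∀ p ∈ frontier Ω, ∃ r > 0, ∃ L : E3 ≃ₗᵢ[ℝ] E3, ∃ γ : ℝ × ℝ → ℝ,
    ContDiff ℝ 1 γ ∧ ∀ x ∈ Metric.ball p r, x ∈ Ω ↔ γ (L x 0, L x 1) < L x 2

/-- `f ∈ C¹(Ω̄, ℝ)`: `f` is continuous on the closure, `C¹` in `Ω`, and its derivative extends
continuously to the closure. -/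
structure IsC1Closure (Ω : Set E3) (f : E3 → ℝ) : Prop where
  continuousOn : ContinuousOn f (closure Ω)
  contDiffOn : ContDiffOn ℝ 1 f Ω
  extends_deriv : ∃ G : E3 → E3 →L[ℝ] ℝ, ContinuousOn G (closure Ω) ∧ ∀ x ∈ Ω, fderiv ℝ f x = G x

/-- Lebesgue measure on `Ω`. -/
abbrev vol (Ω : Set E3) : Measure E3 := volume.restrict Ω

/-- Surface measure on `∂Ω`: the two-dimensional Hausdorff measure, normalised so that it agrees
with Lebesgue measure on planes. -/
abbrev surf (Ω : Set E3) : Measure E3 := (μHE[2] : Measure E3).restrict (frontier Ω)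

/-! ### Sobolev space, trace, norms -/

section Sobolev

variable {F : Type*} [NormedAddCommGroup F] [NormedSpace ℝ F]

/-- `φ` is a real test function: `C¹` with compact support contained in `Ω`. -/
structure IsTest (Ω : Set E3) (φ : E3 → ℝ) : Prop where
  contDiff : ContDiff ℝ 1 φ
  hasCompactSupport : HasCompactSupport φ
  tsupport_subset : tsupport φ ⊆ Ω

/-- `u ∈ H¹(Ω, F)` with weak gradient `Du = (∂₁u, ∂₂u, ∂₃u)`. -/
structure IsH1 (Ω : Set E3) (u : E3 → F) (Du : Fin 3 → E3 → F) : Prop where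
  memLp : MemLp u 2 (vol Ω)
  memLp_deriv : ∀ i, MemLp (Du i) 2 (vol Ω)
  weak_deriv : ∀ i φ, IsTest Ω φ → ∫ x in Ω, φ x • Du i x = - ∫ x in Ω, pd i φ x • u x

/-- `g ∈ L²(∂Ω, F)` is the boundary trace of the `H¹(Ω, F)` function `u` (with weak gradient `Du`):
the limit in `L²(∂Ω)` of the boundary values of functions that are `C¹` up to the boundary and
converge to `u` in `H¹(Ω)`. On a bounded `C¹` domain every `H¹` function has exactly one trace. -/
def IsTrace (Ω : Set E3) (u : E3 → F) (Du : Fin 3 → E3 → F) (g : E3 → F) : Prop :=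
  MemLp g 2 (surf Ω) ∧
  ∃ U : ℕ → E3 → F, (∀ n, ContDiff ℝ 1 (U n)) ∧
    Tendsto (fun n => eLpNorm (fun x => U n x - u x) 2 (vol Ω)) atTop (𝓝 0) ∧
    (∀ i, Tendsto (fun n => eLpNorm (fun x => pd i (U n) x - Du i x) 2 (vol Ω)) atTop (𝓝 0)) ∧
    Tendsto (fun n => eLpNorm (fun x => U n x - g x) 2 (surf Ω)) atTop (𝓝 0)

/-- `‖∇u‖_{L²(Ω)}`. -/
def gradNorm (Ω : Set E3) (Du : Fin 3 → E3 → F) : ℝ≥0∞ :=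
  (∑ i, eLpNorm (Du i) 2 (vol Ω) ^ 2) ^ (1 / 2 : ℝ)

/-- `‖u‖_{H¹(Ω)}`. -/
def h1Norm (Ω : Set E3) (u : E3 → F) (Du : Fin 3 → E3 → F) : ℝ≥0∞ :=
  (eLpNorm u 2 (vol Ω) ^ 2 + ∑ i, eLpNorm (Du i) 2 (vol Ω) ^ 2) ^ (1 / 2 : ℝ)

/-- The Sobolev–Slobodeckij norm of `H^{1/2}(∂Ω)`, where `∂Ω` is two-dimensional:
`‖g‖² = ∫ |g|² dS + ∬ |g(x) - g(y)|² / |x - y|³ dS dS`. -/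
def hHalfNorm (Ω : Set E3) (g : E3 → F) : ℝ≥0∞ :=
  ((∫⁻ x, ‖g x‖ₑ ^ 2 ∂(surf Ω)) +
    ∫⁻ x, ∫⁻ y, ‖g x - g y‖ₑ ^ 2 / edist x y ^ 3 ∂(surf Ω) ∂(surf Ω)) ^ (1 / 2 : ℝ)

end Sobolev

/-- `C` is a constant of the trace inequality `‖u‖_{H^{1/2}(∂Ω)} ≤ C ‖u‖_{H¹(Ω)}`,
`u ∈ H¹(Ω, ℝ)`. -/
def IsTraceConstant (Ω : Set E3) (C : ℝ) : Prop :=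
  0 < C ∧ ∀ (u : E3 → ℝ) (Du : Fin 3 → E3 → ℝ) (g : E3 → ℝ), IsH1 Ω u Du → IsTrace Ω u Du g →
    hHalfNorm Ω g ≤ ENNReal.ofReal C * h1Norm Ω u Du

/-- `C` is a constant of the Poincaré–Wirtinger inequality
`‖u - |Ω|⁻¹ ∫ u‖_{L²(Ω)} ≤ C ‖∇u‖_{L²(Ω)}`, `u ∈ H¹(Ω, ℝ)`. -/
def IsPoincareWirtingerConstant (Ω : Set E3) (C : ℝ) : Prop :=
  0 < C ∧ ∀ (u : E3 → ℝ) (Du : Fin 3 → E3 → ℝ), IsH1 Ω u Du →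
    eLpNorm (fun x => u x - ⨍ y in Ω, u y) 2 (vol Ω) ≤ ENNReal.ofReal C * gradNorm Ω Du

/-! ### The constants of the coefficients -/

/-- `C_T = min_ℓ inf_Ω a_ℓ²`. -/
def constT (Ω : Set E3) (a : Fin 3 → E3 → ℝ) : ℝ := ⨅ l : Fin 3, ⨅ x : Ω, a l x ^ 2

/-- `C'_T = ∑_{i,ℓ} ‖a_ℓ ∂_{x_ℓ} a_i‖_∞`. -/
def constT' (Ω : Set E3) (a : Fin 3 → E3 → ℝ) : ℝ :=
  ∑ i : Fin 3, ∑ l : Fin 3, ⨆ x : Ω, |a l x * pd l (a i) x|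

/-- `K_{a,Ω} = C_{∂Ω}² ‖a‖_∞`, with `b` in the role of the boundary coefficient. -/
def constK (Ω : Set E3) (b : E3 → ℝ) (Ctr : ℝ) : ℝ := Ctr ^ 2 * ⨆ x : frontier Ω, |b x|

/-! ### Quaternions -/

/-- The imaginary units `e₁, e₂, e₃` of the quaternions. -/
def e : Fin 3 → ℍ[ℝ] := ![⟨0, 1, 0, 0⟩, ⟨0, 0, 1, 0⟩, ⟨0, 0, 0, 1⟩]

/-- The power `s^β = |s|^β (cos βθ + J sin βθ)` of a quaternion `s = |s| (cos θ + J sin θ)`,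
`J = Im s / |Im s|`, `θ = arccos (Re s / |s|)`, off the half line `(-∞, 0]`. -/
def qpow (s : ℍ[ℝ]) (β : ℝ) : ℍ[ℝ] :=
  (‖s‖ ^ β) • (((Real.cos (β * Real.arccos (s.re / ‖s‖)) : ℝ) : ℍ[ℝ]) +
    (Real.sin (β * Real.arccos (s.re / ‖s‖)) / ‖s.im‖) • s.im)

/-- The two-sided quaternionic Hilbert space `L²(Ω, ℍ)`. -/
abbrev V (Ω : Set E3) : Type := Lp ℍ[ℝ] 2 (vol Ω)

/-! ### The operator `T = ∑ e_ℓ a_ℓ ∂_{x_ℓ}` -/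

/-- `w = T v` in the sense of distributions on `Ω`, for `v, w ∈ L²(Ω, ℍ)`. -/
def IsVecOp (Ω : Set E3) (a : Fin 3 → E3 → ℝ) (v w : V Ω) : Prop :=
  ∀ φ, IsTest Ω φ → ∫ x in Ω, φ x • w x =
    - ∑ l, ∫ x in Ω, pd l (fun y => a l y * φ y) x • (e l * v x)

/-- The domain of `T` as a closed operator in `L²(Ω, ℍ)`: all `v ∈ L²` with `T v ∈ L²`. -/
def domT (Ω : Set E3) (a : Fin 3 → E3 → ℝ) : Set (V Ω) := {v | ∃ w, IsVecOp Ω a v w}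

open Classical in
/-- `T v` for `v ∈ dom(T)` (and `0` for other `v`). -/
def opT (Ω : Set E3) (a : Fin 3 → E3 → ℝ) (v : V Ω) : V Ω :=
  if h : ∃ w, IsVecOp Ω a v w then h.choose else 0

/-! ### The operator `Q_s(T) = T² - 2 Re(s) T + |s|²` with the Robin condition -/

/-- The vector part of `Q_s(T)` applied to `u` with weak gradient `Du`. In the vector part
`∑_{ℓ ≠ i} e_ℓ e_i a_ℓ ∂_ℓ (a_i ∂_i u)` of `T² u` the second order terms cancel. -/
def vectQ (a : Fin 3 → E3 → ℝ) (s : ℍ[ℝ]) (Du : Fin 3 → E3 → ℍ[ℝ]) (x : E3) : ℍ[ℝ] :=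
  (∑ l, ∑ i, if l = i then 0 else (a l x * pd l (a i) x) • (e l * e i * Du i x))
    - (2 * s.re) • ∑ l, a l x • (e l * Du l x)

/-- The sesquilinear form of `Q_s(T)` with the boundary condition
`b u + ∑ a_ℓ² n_ℓ ∂_ℓ u = 0` on `∂Ω`; `g` and `h` are the traces of `u` and `v`. -/
def formQ (Ω : Set E3) (a : Fin 3 → E3 → ℝ) (b : E3 → ℝ) (s : ℍ[ℝ])
    (u : E3 → ℍ[ℝ]) (Du : Fin 3 → E3 → ℍ[ℝ]) (g : E3 → ℍ[ℝ])
    (v : E3 → ℍ[ℝ]) (Dv : Fin 3 → E3 → ℍ[ℝ]) (h : E3 → ℍ[ℝ]) : ℍ[ℝ] :=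
  (∑ l, ∫ x in Ω, star (a l x • Du l x) * (a l x • Dv l x))
    + (1 / 2 : ℝ) • (∑ l, ∫ x in Ω, star (Du l x) * (pd l (fun y => a l y ^ 2) x • v x))
    + (∫ x in Ω, star (vectQ a s Du x) * v x)
    + (∫ x, b x • (star (g x) * h x) ∂(surf Ω))
    + (‖s‖ ^ 2) • ∫ x in Ω, star (u x) * v x

/-- `(u, Du, g)` is an element of `𝓗 = {u ∈ H¹(Ω, ℍ) | ∫_Ω u = 0}` with its weak gradient and
its trace. -/
structure IsMeanZeroH1 (Ω : Set E3) (u : E3 → ℍ[ℝ]) (Du : Fin 3 → E3 → ℍ[ℝ]) (g : E3 → ℍ[ℝ]) :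
    Prop where
  isH1 : IsH1 Ω u Du
  isTrace : IsTrace Ω u Du g
  mean_zero : ∫ x in Ω, u x = 0

/-- `u` is a weak solution in `𝓗` of `Q_s(T) u = F` with the Robin boundary condition. -/
def IsWeakSol (Ω : Set E3) (a : Fin 3 → E3 → ℝ) (b : E3 → ℝ) (s : ℍ[ℝ]) (F u : V Ω) : Prop :=
  ∃ Du g, IsMeanZeroH1 Ω u Du g ∧ ∀ v Dv h, IsMeanZeroH1 Ω v Dv h →
    formQ Ω a b s u Du g v Dv h = ∫ x in Ω, star (F x) * v x

/-- The bounded right linear operator `R` is the inverse of `Q_s(T)`: for each `F`, `R F` is the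
unique weak solution of `Q_s(T) u = F`. -/
def IsInverseQ (Ω : Set E3) (a : Fin 3 → E3 → ℝ) (b : E3 → ℝ) (s : ℍ[ℝ])
    (R : V Ω →L[ℍ[ℝ]ᵐᵒᵖ] V Ω) : Prop :=
  ∀ F u, IsWeakSol Ω a b s F u ↔ u = R F

/-- The `S`-resolvent set. -/
def sResolventSet (Ω : Set E3) (a : Fin 3 → E3 → ℝ) (b : E3 → ℝ) : Set ℍ[ℝ] :=
  {s | ∃ R, IsInverseQ Ω a b s R}

open Classical in
/-- The pseudo `S`-resolvent operator `Q_s(T)⁻¹` (and `0` off the `S`-resolvent set). -/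
def pseudoRes (Ω : Set E3) (a : Fin 3 → E3 → ℝ) (b : E3 → ℝ) (s : ℍ[ℝ]) :
    V Ω →L[ℍ[ℝ]ᵐᵒᵖ] V Ω :=
  if h : ∃ R, IsInverseQ Ω a b s R then h.choose else 0

/-- The left `S`-resolvent operator `Q_s(T)⁻¹ s̄ - T Q_s(T)⁻¹`. -/
def leftSRes (Ω : Set E3) (a : Fin 3 → E3 → ℝ) (b : E3 → ℝ) (s : ℍ[ℝ]) (F : V Ω) : V Ω :=
  pseudoRes Ω a b s (star s • F) - opT Ω a (pseudoRes Ω a b s F)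

/-- The right `S`-resolvent operator `-(T - s̄) Q_s(T)⁻¹`. -/
def rightSRes (Ω : Set E3) (a : Fin 3 → E3 → ℝ) (b : E3 → ℝ) (s : ℍ[ℝ]) (F : V Ω) : V Ω :=
  -(opT Ω a (pseudoRes Ω a b s F) - star s • pseudoRes Ω a b s F)

/-! ### The integrands of the fractional powers -/

/-- The integrand of `(2π)⁻¹ ∫_{-Iℝ} S_L⁻¹(s,T) ds_I s^{α-1} T v`, `ds_I = ds / I`, under the
parametrisation `s = -I t`, `ds = -I dt`. -/
def integrandL (Ω : Set E3) (a : Fin 3 → E3 → ℝ) (b : E3 → ℝ) (I : ℍ[ℝ]) (α : ℝ) (v : V Ω)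
    (t : ℝ) : V Ω :=
  (2 * Real.pi)⁻¹ •
    leftSRes Ω a b (-(t • I)) (((-I) * I⁻¹ * qpow (-(t • I)) (α - 1)) • opT Ω a v)

/-- The integrand of `(2π)⁻¹ ∫_{-Iℝ} s^{α-1} ds_I S_R⁻¹(s,T) T v`, under the same
parametrisation. -/
def integrandR (Ω : Set E3) (a : Fin 3 → E3 → ℝ) (b : E3 → ℝ) (I : ℍ[ℝ]) (α : ℝ) (v : V Ω)
    (t : ℝ) : V Ω :=
  (2 * Real.pi)⁻¹ •
    ((qpow (-(t • I)) (α - 1) * ((-I) * I⁻¹)) • rightSRes Ω a b (-(t • I)) (opT Ω a v))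

end RobinFractional

end

/-! For `Re s = 0` the term `-2 Re(s) T` drops out, so the form of `Q_s(T)` depends on `s` only
through the added term `|s|² ⟪u, v⟫`. On mean-zero functions the remaining form is coercive: its
principal part is at least `C_T ‖∇u‖²`, the first order terms cost at most `C_T' ‖∇u‖ ‖u‖ ≤ C_T' C_P
‖∇u‖²`, and the boundary term costs at most `K (1 + C_P²) ‖∇u‖²` (`robinForm_self_ge`). Lax–Milgram
then solves the problem for every purely imaginary `s`.

Testing the equation with its own solution `u` bounds both `δ ‖u‖²` (in the norm of function,
gradient and trace) and `|s|² ‖u‖²` (in `L²`) by `‖F‖ ‖u‖`. Hence the `H¹` size of `u` is `O(1)` and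
`O(1/|s|)`, and its `L²` size is `O(1/|s|²)`. As `T` is of first order, `T Q_s(T)⁻¹` and `|s|
Q_s(T)⁻¹` are both bounded near `0` and `O(1/|s|)` at infinity. With the factor `|s|^(α-1)` the
integrands are `O(|t|^(α-1))` near `0` and `O(|t|^(α-2))` at infinity, which is integrable exactly
because `0 < α < 1`. Measurability comes from norm continuity of the solution operators in `t`.

The Hilbert space consists of triples (function, gradient, trace). Traces are defined by
approximation, so admissible triples form a closed subspace and no trace theorem is needed. The
quaternionic equation is equivalent to its real part, since test functions may be multiplied by
constants on the right. -/

noncomputable section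

namespace RobinFractional

/-! ### Coercive forms with a spectral parameter -/

section Coercive

variable {X Y : Type*} [NormedAddCommGroup X] [InnerProductSpace ℝ X]
  [NormedAddCommGroup Y] [InnerProductSpace ℝ Y]

/-- The real inner product as a continuous bilinear map. -/
def innerBilin (Y : Type*) [NormedAddCommGroup Y] [InnerProductSpace ℝ Y] : Y →L[ℝ] Y →L[ℝ] ℝ :=
  (isBoundedBilinearMap_inner (𝕜 := ℝ) (E := Y)).toContinuousLinearMap

@[simp]
theorem innerBilin_apply (x y : Y) : innerBilin Y x y = inner ℝ x y := rfl

/-- The form `B + t² ⟪P ·, P ·⟫`. -/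
def shiftedForm (B : X →L[ℝ] X →L[ℝ] ℝ) (P : X →L[ℝ] Y) (t : ℝ) : X →L[ℝ] X →L[ℝ] ℝ :=
  B + (t ^ 2) • (innerBilin Y).bilinearComp P P

theorem shiftedForm_apply (B : X →L[ℝ] X →L[ℝ] ℝ) (P : X →L[ℝ] Y) (t : ℝ) (x y : X) :
    shiftedForm B P t x y = B x y + t ^ 2 * inner ℝ (P x) (P y) := by
  simp [shiftedForm]

/-- `x ∈ H` solves the variational equation `B x y + t² ⟪P x, P y⟫ = ⟪F, P y⟫` for `y ∈ H`. -/
def IsVarSol (H : Submodule ℝ X) (B : X →L[ℝ] X →L[ℝ] ℝ) (P : X →L[ℝ] Y) (t : ℝ) (F : Y) (x : X) :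
    Prop :=
  x ∈ H ∧ ∀ y ∈ H, B x y + t ^ 2 * inner ℝ (P x) (P y) = inner ℝ F (P y)

variable {H : Submodule ℝ X} {B : X →L[ℝ] X →L[ℝ] ℝ} {P : X →L[ℝ] Y} {δ : ℝ}

theorem IsVarSol.sub {t : ℝ} {F G : Y} {x y : X} (hx : IsVarSol H B P t F x)
    (hy : IsVarSol H B P t G y) : IsVarSol H B P t (F - G) (x - y) := by
  refine ⟨H.sub_mem hx.1 hy.1, fun z hz => ?_⟩
  have h1 := hx.2 z hz
  have h2 := hy.2 z hz
  simp only [map_sub, sub_apply, inner_sub_left]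
  linarith

/-- Changing the parameter is absorbed into the datum. This plays the role of a resolvent identity
in the proof of continuity in `t`. -/
theorem IsVarSol.shift {t t' : ℝ} {F : Y} {x : X} (hx : IsVarSol H B P t' F x) :
    IsVarSol H B P t (F + (t ^ 2 - t' ^ 2) • P x) x := by
  refine ⟨hx.1, fun z hz => ?_⟩
  have h1 := hx.2 z hz
  simp only [inner_add_left, real_inner_smul_left]
  linarith

/-- The energy estimate, from testing with `y = x`. The next three bounds all follow from it. -/
theorem IsVarSol.norm_sq_add_le {t : ℝ} {F : Y} {x : X} (hx : IsVarSol H B P t F x)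
    (hB : ∀ x ∈ H, δ * ‖x‖ ^ 2 ≤ B x x) :
    δ * ‖x‖ ^ 2 + t ^ 2 * ‖P x‖ ^ 2 ≤ ‖F‖ * ‖P x‖ := by
  have h1 := hx.2 x hx.1
  rw [real_inner_self_eq_norm_sq] at h1
  have h2 := real_inner_le_norm F (P x)
  have h3 := hB x hx.1
  linarith

theorem IsVarSol.norm_le {t : ℝ} {F : Y} {x : X} (hx : IsVarSol H B P t F x) (hδ : 0 < δ)
    (hB : ∀ x ∈ H, δ * ‖x‖ ^ 2 ≤ B x x) : ‖x‖ ≤ δ⁻¹ * ‖P‖ * ‖F‖ := by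
  have h := hx.norm_sq_add_le hB
  have hP := P.le_opNorm x
  have h1 : δ * ‖x‖ ^ 2 ≤ ‖F‖ * (‖P‖ * ‖x‖) := by
    have : 0 ≤ t ^ 2 * ‖P x‖ ^ 2 := by positivity
    have := mul_le_mul_of_nonneg_left hP (norm_nonneg F)
    linarith
  rcases (norm_nonneg x).eq_or_lt with h0 | h0
  · rw [← h0]; positivity
  · have h2 : (δ * ‖x‖) * ‖x‖ ≤ (‖P‖ * ‖F‖) * ‖x‖ := by linarith
    have h3 := le_of_mul_le_mul_right h2 h0
    rw [mul_assoc, inv_mul_eq_div, le_div_iff₀ hδ]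
    linarith

/-- Dropping the coercive term instead of the shift gives quadratic decay, but only for `P x`. -/
theorem IsVarSol.sq_mul_norm_le {t : ℝ} {F : Y} {x : X} (hx : IsVarSol H B P t F x) (hδ : 0 < δ)
    (hB : ∀ x ∈ H, δ * ‖x‖ ^ 2 ≤ B x x) : t ^ 2 * ‖P x‖ ≤ ‖F‖ := by
  have h := hx.norm_sq_add_le hB
  rcases (norm_nonneg (P x)).eq_or_lt with h0 | h0
  · rw [← h0]; simp
  · have : 0 ≤ δ * ‖x‖ ^ 2 := by positivity
    exact le_of_mul_le_mul_right (by linarith) h0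

/-- Interpolates between the two previous bounds: the coercive estimate is multiplied by `t²` and
`t² ‖P x‖ ≤ ‖F‖` is inserted. This is the decay available for the gradient. -/
theorem IsVarSol.abs_mul_norm_le {t : ℝ} {F : Y} {x : X} (hx : IsVarSol H B P t F x) (hδ : 0 < δ)
    (hB : ∀ x ∈ H, δ * ‖x‖ ^ 2 ≤ B x x) : |t| * ‖x‖ ≤ (√δ)⁻¹ * ‖F‖ := by
  have h := hx.norm_sq_add_le hB
  have h1 := hx.sq_mul_norm_le hδ hB
  rw [inv_mul_eq_div, le_div_iff₀ (Real.sqrt_pos.2 hδ)]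
  refine abs_le_of_sq_le_sq' ?_ (norm_nonneg _) |>.2
  rw [mul_pow, mul_pow, Real.sq_sqrt hδ.le, sq_abs]
  have h2 : δ * ‖x‖ ^ 2 ≤ ‖F‖ * ‖P x‖ := by
    have : 0 ≤ t ^ 2 * ‖P x‖ ^ 2 := by positivity
    linarith
  calc t ^ 2 * ‖x‖ ^ 2 * δ = t ^ 2 * (δ * ‖x‖ ^ 2) := by ring
    _ ≤ t ^ 2 * (‖F‖ * ‖P x‖) := by gcongr
    _ = ‖F‖ * (t ^ 2 * ‖P x‖) := by ring
    _ ≤ ‖F‖ * ‖F‖ := by gcongr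
    _ = ‖F‖ ^ 2 := by ring

theorem IsVarSol.unique {t : ℝ} {F : Y} {x y : X} (hx : IsVarSol H B P t F x)
    (hy : IsVarSol H B P t F y) (hδ : 0 < δ) (hB : ∀ x ∈ H, δ * ‖x‖ ^ 2 ≤ B x x) : x = y := by
  have h := (hx.sub hy).norm_le hδ hB
  rw [sub_self, norm_zero, mul_zero] at h
  exact sub_eq_zero.1 (norm_le_zero_iff.1 h)

/-- The Lax–Milgram theorem for the shifted form, on a closed subspace. -/
theorem exists_varSol [CompleteSpace X] [CompleteSpace Y] (hH : IsClosed (H : Set X)) (hδ : 0 < δ)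
    (hB : ∀ x ∈ H, δ * ‖x‖ ^ 2 ≤ B x x) (t : ℝ) :
    ∃ S : Y →L[ℝ] X, ∀ F, IsVarSol H B P t F (S F) := by
  have : CompleteSpace H := hH.completeSpace_coe
  have hco : IsCoercive ((shiftedForm B P t).bilinearComp H.subtypeL H.subtypeL) := by
    refine ⟨δ, hδ, fun u => ?_⟩
    have h := hB u u.2
    have h2 : 0 ≤ t ^ 2 * ‖P u‖ ^ 2 := by positivity
    simp only [ContinuousLinearMap.bilinearComp_apply, Submodule.subtypeL_apply, shiftedForm_apply,
      real_inner_self_eq_norm_sq]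
    rw [Submodule.coe_norm]
    linarith [mul_assoc δ ‖(u : X)‖ ‖(u : X)‖, sq ‖(u : X)‖, congrArg (δ * ·) (sq ‖(u : X)‖)]
  -- With `A` the operator of the form on `H`, the equation reads `A x = (P|_H)* F`, so the solution
  -- operator is `A⁻¹ (P|_H)*` followed by the inclusion.
  refine ⟨H.subtypeL ∘L (hco.continuousLinearEquivOfBilin.symm : H →L[ℝ] H) ∘L
    (ContinuousLinearMap.adjoint (P ∘L H.subtypeL)), fun F => ⟨by simp, fun y hy => ?_⟩⟩
  set w := ContinuousLinearMap.adjoint (P ∘L H.subtypeL) F with hw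
  have h := hco.continuousLinearEquivOfBilin_apply (hco.continuousLinearEquivOfBilin.symm w) ⟨y, hy⟩
  rw [ContinuousLinearEquiv.apply_symm_apply, hw, ContinuousLinearMap.adjoint_inner_left] at h
  simp only [ContinuousLinearMap.bilinearComp_apply, Submodule.subtypeL_apply,
    shiftedForm_apply, ContinuousLinearMap.comp_apply] at h
  exact h.symm

/-- The solution operators of the shifted problems depend continuously on the parameter. -/
theorem exists_continuous_varSol [CompleteSpace X] [CompleteSpace Y] (hH : IsClosed (H : Set X)) (hδ : 0 < δ)
    (hB : ∀ x ∈ H, δ * ‖x‖ ^ 2 ≤ B x x) :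
    ∃ S : ℝ → Y →L[ℝ] X, Continuous S ∧ ∀ t F, IsVarSol H B P t F (S t F) := by
  choose S hS using exists_varSol (P := P) hH hδ hB
  refine ⟨S, ?_, hS⟩
  set K := δ⁻¹ * ‖P‖ with hK
  have hKnn : 0 ≤ K := by positivity
  -- `S t F - S t' F` solves the problem at `t` with datum `(t'² - t²) P (S t' F)`, so `S` is
  -- Lipschitz in `t²`.
  have key : ∀ t t', ‖S t - S t'‖ ≤ K * ‖P‖ * K * |t' ^ 2 - t ^ 2| := fun t t' => by
    refine ContinuousLinearMap.opNorm_le_bound _ (by positivity) fun F => ?_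
    have h1 := ((hS t F).sub ((hS t' F).shift (t := t))).norm_le hδ hB
    have h2 := (hS t' F).norm_le hδ hB
    have h3 := P.le_opNorm (S t' F)
    rw [sub_add_cancel_left, norm_neg, norm_smul, Real.norm_eq_abs, abs_sub_comm] at h1
    calc ‖(S t - S t') F‖ ≤ K * (|t' ^ 2 - t ^ 2| * ‖P (S t' F)‖) := h1
      _ ≤ K * (|t' ^ 2 - t ^ 2| * (‖P‖ * (K * ‖F‖))) := by
        gcongr
        exact h3.trans (by gcongr)
      _ = _ := by ring
  refine continuous_iff_continuousAt.2 fun t' => ?_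
  rw [ContinuousAt, tendsto_iff_norm_sub_tendsto_zero]
  refine squeeze_zero (fun _ => norm_nonneg _) (fun t => key t t') ?_
  have : Continuous fun t : ℝ => K * ‖P‖ * K * |t' ^ 2 - t ^ 2| := by fun_prop
  simpa using this.tendsto t'

end Coercive

/-! ### Quaternion-valued square integrable functions -/

section LpQuaternion

variable {μ : Measure E3}

/-- Left multiplication by an essentially bounded quaternionic function on `L²`. -/
def lmul {m : E3 → ℍ[ℝ]} (hm : MemLp m ∞ μ) : Lp ℍ[ℝ] 2 μ →L[ℝ] Lp ℍ[ℝ] 2 μ :=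
  (ContinuousLinearMap.mul ℝ ℍ[ℝ]).holderL μ ∞ 2 2 (hm.toLp m)

theorem lmul_ae {m : E3 → ℍ[ℝ]} (hm : MemLp m ∞ μ) (f : Lp ℍ[ℝ] 2 μ) :
    lmul hm f =ᵐ[μ] fun x => m x * f x := by
  have h := (ContinuousLinearMap.mul ℝ ℍ[ℝ]).coeFn_holder (r := 2) (hm.toLp m) f
  refine h.trans ?_
  filter_upwards [hm.coeFn_toLp] with x hx
  simp [hx]

theorem norm_lmul_le {m : E3 → ℍ[ℝ]} (hm : MemLp m ∞ μ) {C : ℝ} (hC : ∀ᵐ x ∂μ, ‖m x‖ ≤ C)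
    (f : Lp ℍ[ℝ] 2 μ) : ‖lmul hm f‖ ≤ C * ‖f‖ := by
  refine Lp.norm_le_mul_norm_of_ae_le_mul ?_
  filter_upwards [hC, lmul_ae hm f] with x hx hx'
  rw [hx', norm_mul]
  gcongr

theorem coeFn_op_smul (c : ℍ[ℝ]) (f : Lp ℍ[ℝ] 2 μ) :
    (MulOpposite.op c • f : Lp ℍ[ℝ] 2 μ) =ᵐ[μ] fun x => f x * c := by
  filter_upwards [Lp.coeFn_smul (MulOpposite.op c) f] with x hx
  simp [hx]

theorem lmul_op_smul {m : E3 → ℍ[ℝ]} (hm : MemLp m ∞ μ) (c : ℍ[ℝ]) (f : Lp ℍ[ℝ] 2 μ) :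
    lmul hm (MulOpposite.op c • f) = MulOpposite.op c • lmul hm f := by
  refine Lp.ext ?_
  filter_upwards [lmul_ae hm f, lmul_ae hm (MulOpposite.op c • f), coeFn_op_smul c f,
    coeFn_op_smul c (lmul hm f)] with x h1 h2 h3 h4
  rw [h2, h3, h4, h1, mul_assoc]

theorem inner_eq_re_star_mul (p q : ℍ[ℝ]) : inner ℝ p q = (star p * q).re := by
  simp [Quaternion.inner_def]

/-- Right multiplications by `c` and by `star c` are adjoint for the real inner product. -/
theorem inner_op_smul (c : ℍ[ℝ]) (f g : Lp ℍ[ℝ] 2 μ) :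
    inner ℝ (MulOpposite.op c • f) g = inner ℝ f (MulOpposite.op (star c) • g) := by
  rw [L2.inner_def, L2.inner_def]
  refine integral_congr_ae ?_
  filter_upwards [coeFn_op_smul c f, coeFn_op_smul (star c) g] with x h1 h2
  rw [h1, h2, Quaternion.inner_def, Quaternion.inner_def, star_mul, star_star, mul_assoc]

theorem integrable_star_mul {p q : E3 → ℍ[ℝ]} (hp : MemLp p 2 μ) (hq : MemLp q 2 μ) :
    Integrable (fun x => star (p x) * q x) μ :=
  MemLp.integrable_mul (f := fun x => star (p x)) hp.star hq

theorem re_integral {f : E3 → ℍ[ℝ]} (hf : Integrable f μ) : (∫ x, f x ∂μ).re = ∫ x, (f x).re ∂μ :=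
  by simpa [inner_eq_re_star_mul] using ((innerSL ℝ (1 : ℍ[ℝ])).integral_comp_comm hf).symm

theorem re_integral_star_mul (p q : Lp ℍ[ℝ] 2 μ) :
    (∫ x, star (p x) * q x ∂μ).re = inner ℝ p q := by
  rw [re_integral (integrable_star_mul (Lp.memLp p) (Lp.memLp q)), L2.inner_def]
  simp_rw [inner_eq_re_star_mul]

theorem integral_star_mul_op_smul (p q : Lp ℍ[ℝ] 2 μ) (c : ℍ[ℝ]) :
    ∫ x, star (p x) * (MulOpposite.op c • q : Lp ℍ[ℝ] 2 μ) x ∂μ =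
      (∫ x, star (p x) * q x ∂μ) * c := by
  rw [← integral_mul_const_of_integrable (integrable_star_mul (Lp.memLp p) (Lp.memLp q))]
  refine integral_congr_ae ?_
  filter_upwards [coeFn_op_smul c q] with x h1
  rw [h1, mul_assoc]

/-- The choice `c = star (z - w)` suffices. This recovers quaternionic identities from their real
parts. -/
theorem eq_of_re_mul_eq {z w : ℍ[ℝ]} (h : ∀ c, (z * c).re = (w * c).re) : z = w := by
  rw [← sub_eq_zero, ← Quaternion.normSq_eq_zero, ← Quaternion.inner_self, Quaternion.inner_def,
    sub_mul, Quaternion.re_sub, h, sub_self]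

end LpQuaternion

/-! ### The graph space -/

section Graph

variable {Ω : Set E3}

/-- Triples consisting of a function, a candidate gradient and candidate boundary values. -/
abbrev GraphSpace (Ω : Set E3) : Type :=
  WithLp 2 (PiLp 2 (fun _ : Fin 4 => V Ω) × Lp ℍ[ℝ] 2 (surf Ω))

/-- The function of a triple. -/
def val : GraphSpace Ω →L[ℝ] V Ω :=
  PiLp.proj 2 (fun _ : Fin 4 => V Ω) 0 ∘L
    WithLp.fstL 2 ℝ (PiLp 2 (fun _ : Fin 4 => V Ω)) (Lp ℍ[ℝ] 2 (surf Ω))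

/-- The gradient of a triple. -/
def grad (i : Fin 3) : GraphSpace Ω →L[ℝ] V Ω :=
  PiLp.proj 2 (fun _ : Fin 4 => V Ω) i.succ ∘L
    WithLp.fstL 2 ℝ (PiLp 2 (fun _ : Fin 4 => V Ω)) (Lp ℍ[ℝ] 2 (surf Ω))

/-- The boundary values of a triple. -/
def tr : GraphSpace Ω →L[ℝ] Lp ℍ[ℝ] 2 (surf Ω) :=
  WithLp.sndL 2 ℝ (PiLp 2 (fun _ : Fin 4 => V Ω)) (Lp ℍ[ℝ] 2 (surf Ω))

/-- The triple with given components. -/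
def triple (u : V Ω) (Du : Fin 3 → V Ω) (g : Lp ℍ[ℝ] 2 (surf Ω)) : GraphSpace Ω :=
  WithLp.toLp 2 (WithLp.toLp 2 (Fin.cons (α := fun _ => V Ω) u Du), g)

@[simp]
theorem val_triple (u : V Ω) (Du : Fin 3 → V Ω) (g : Lp ℍ[ℝ] 2 (surf Ω)) :
    val (triple u Du g) = u := rfl

@[simp]
theorem grad_triple (u : V Ω) (Du : Fin 3 → V Ω) (g : Lp ℍ[ℝ] 2 (surf Ω)) (i : Fin 3) :
    grad i (triple u Du g) = Du i := rfl

@[simp]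
theorem tr_triple (u : V Ω) (Du : Fin 3 → V Ω) (g : Lp ℍ[ℝ] 2 (surf Ω)) :
    tr (triple u Du g) = g := rfl

theorem val_op_smul (c : ℍ[ℝ]ᵐᵒᵖ) (x : GraphSpace Ω) : val (c • x) = c • val x := rfl

theorem grad_op_smul (c : ℍ[ℝ]ᵐᵒᵖ) (x : GraphSpace Ω) (i : Fin 3) :
    grad i (c • x) = c • grad i x := rfl

theorem tr_op_smul (c : ℍ[ℝ]ᵐᵒᵖ) (x : GraphSpace Ω) : tr (c • x) = c • tr x := rfl

theorem graph_norm_sq (x : GraphSpace Ω) :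
    ‖x‖ ^ 2 = ‖val x‖ ^ 2 + ∑ i, ‖grad i x‖ ^ 2 + ‖tr x‖ ^ 2 := by
  rw [WithLp.prod_norm_sq_eq_of_L2, PiLp.norm_sq_eq_of_L2, Fin.sum_univ_succ]
  rfl

/-- The graphs of functions of class `C¹` on the whole space. -/
def smoothGraph (Ω : Set E3) : Submodule ℝ (GraphSpace Ω) where
  carrier := {x | ∃ U : E3 → ℍ[ℝ], ContDiff ℝ 1 U ∧ val x =ᵐ[vol Ω] U ∧
    (∀ i, grad i x =ᵐ[vol Ω] pd i U) ∧ tr x =ᵐ[surf Ω] U}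
  zero_mem' := by
    refine ⟨0, contDiff_const, ?_, fun i => ?_, ?_⟩
    · rw [map_zero]; exact Lp.coeFn_zero _ _ _
    · rw [map_zero]
      refine (Lp.coeFn_zero _ _ _).trans (Eventually.of_forall fun x => ?_)
      simp [pd]
    · rw [map_zero]; exact Lp.coeFn_zero _ _ _
  add_mem' := by
    rintro x y ⟨U, hU, h1, h2, h3⟩ ⟨W, hW, k1, k2, k3⟩
    refine ⟨U + W, hU.add hW, ?_, fun i => ?_, ?_⟩
    · rw [map_add]; exact (Lp.coeFn_add _ _).trans (h1.add k1)
    · rw [map_add]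
      refine (Lp.coeFn_add _ _).trans (((h2 i).add (k2 i)).trans (Eventually.of_forall fun x => ?_))
      simp [pd, fderiv_add (hU.differentiable one_ne_zero x) (hW.differentiable one_ne_zero x)]
    · rw [map_add]; exact (Lp.coeFn_add _ _).trans (h3.add k3)
  smul_mem' := by
    rintro c x ⟨U, hU, h1, h2, h3⟩
    refine ⟨c • U, hU.const_smul c, ?_, fun i => ?_, ?_⟩
    · rw [map_smul]; exact (Lp.coeFn_smul _ _).trans (h1.const_smul c)
    · rw [map_smul]
      refine (Lp.coeFn_smul _ _).trans (((h2 i).const_smul c).trans (Eventually.of_forall fun x => ?_))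
      simp [pd, fderiv_const_smul (hU.differentiable one_ne_zero x)]
    · rw [map_smul]; exact (Lp.coeFn_smul _ _).trans (h3.const_smul c)

theorem pd_clm_comp {F F' : Type*} [NormedAddCommGroup F] [NormedSpace ℝ F]
    [NormedAddCommGroup F'] [NormedSpace ℝ F'] (L : F →L[ℝ] F') {U : E3 → F}
    (hU : ContDiff ℝ 1 U) (i : Fin 3) (x : E3) : pd i (fun y => L (U y)) x = L (pd i U x) := by
  have h := (L.hasFDerivAt.comp x (hU.differentiable one_ne_zero x).hasFDerivAt).fderiv
  simp only [pd]
  change fderiv ℝ (L ∘ U) x _ = _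
  rw [h]
  rfl

/-- Right multiplication by a quaternion as a real linear map. -/
def rmulL (c : ℍ[ℝ]) : ℍ[ℝ] →L[ℝ] ℍ[ℝ] := (ContinuousLinearMap.mul ℝ ℍ[ℝ]).flip c

theorem rmulL_apply (c x : ℍ[ℝ]) : rmulL c x = x * c := rfl

theorem op_smul_mem_smoothGraph (c : ℍ[ℝ]) {x : GraphSpace Ω} (hx : x ∈ smoothGraph Ω) :
    MulOpposite.op c • x ∈ smoothGraph Ω := by
  obtain ⟨U, hU, h1, h2, h3⟩ := hx
  refine ⟨fun y => rmulL c (U y), (rmulL c).contDiff.comp hU, ?_, fun i => ?_, ?_⟩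
  · rw [val_op_smul]
    filter_upwards [coeFn_op_smul c (val x), h1] with y hy hy'
    rw [hy, hy', rmulL_apply]
  · rw [grad_op_smul]
    filter_upwards [coeFn_op_smul c (grad i x), h2 i] with y hy hy'
    rw [hy, hy', pd_clm_comp _ hU, rmulL_apply]
  · rw [tr_op_smul]
    filter_upwards [coeFn_op_smul c (tr x), h3] with y hy hy'
    rw [hy, hy', rmulL_apply]

theorem op_smul_mem_closure_smoothGraph (c : ℍ[ℝ]) {x : GraphSpace Ω}
    (hx : x ∈ (smoothGraph Ω).topologicalClosure) :
    MulOpposite.op c • x ∈ (smoothGraph Ω).topologicalClosure :=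
  map_mem_closure (continuous_const_smul (MulOpposite.op c)) hx
    fun _ hy => op_smul_mem_smoothGraph c hy

theorem continuous_pd {F : Type*} [NormedAddCommGroup F] [NormedSpace ℝ F] {U : E3 → F}
    (hU : ContDiff ℝ 1 U) (i : Fin 3) : Continuous (pd i U) :=
  (hU.continuous_fderiv one_ne_zero).clm_apply continuous_const

theorem memLp_of_eLpNorm_sub_lt_top {α F : Type*} [MeasurableSpace α] {μ : Measure α}
    [NormedAddCommGroup F] {f g : α → F} (hf : AEStronglyMeasurable f μ) (hg : MemLp g 2 μ)
    (h : eLpNorm (fun x => f x - g x) 2 μ < ∞) : MemLp f 2 μ := by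
  have : MemLp (fun x => f x - g x) 2 μ := ⟨hf.sub hg.1, h⟩
  convert this.add hg using 1
  ext x
  simp

theorem norm_sub_toLp_lt {α F : Type*} [MeasurableSpace α] {μ : Measure α}
    [NormedAddCommGroup F] {f : α → F} (g : Lp F 2 μ) (hf : MemLp f 2 μ) {ε : ℝ} (hε : 0 < ε)
    (h : eLpNorm (fun x => f x - g x) 2 μ < ENNReal.ofReal ε) : ‖g - hf.toLp f‖ < ε := by
  have h1 : ‖hf.toLp f - g‖ₑ = eLpNorm (fun x => f x - g x) 2 μ := by
    rw [Lp.enorm_def]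
    refine eLpNorm_congr_ae ?_
    filter_upwards [Lp.coeFn_sub (hf.toLp f) g, hf.coeFn_toLp] with x h1 h2
    rw [h1, Pi.sub_apply, h2]
  rw [← h1, ← ofReal_norm, ENNReal.ofReal_lt_ofReal_iff hε] at h
  rwa [norm_sub_rev]

/-- The sequences in the definition of the trace are exactly sequences of smooth graphs converging
in the product norm. The trace condition is therefore closed. -/
theorem isTrace_iff_mem_closure (x : GraphSpace Ω) :
    IsTrace Ω (val x) (fun i => grad i x) (tr x) ↔ x ∈ (smoothGraph Ω).topologicalClosure := by
  constructor
  · rintro ⟨-, U, hU, h1, h2, h3⟩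
    refine Metric.mem_closure_iff.2 fun ε hε => ?_
    -- There are five components (function, three derivatives, trace), and `5 (ε/3)² < ε²`.
    have hε3 : 0 < ε / 3 := by positivity
    have hε' : 0 < ENNReal.ofReal (ε / 3) := by simpa using hε
    obtain ⟨n, k1, k2, k3⟩ := ((h1.eventually_lt_const hε').and
      ((eventually_all.2 fun i => (h2 i).eventually_lt_const hε').and
        (h3.eventually_lt_const hε'))).exists
    have m1 : MemLp (U n) 2 (vol Ω) := memLp_of_eLpNorm_sub_lt_top
      (hU n).continuous.aestronglyMeasurable (Lp.memLp (val x)) (k1.trans ENNReal.ofReal_lt_top)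
    have m2 : ∀ i, MemLp (pd i (U n)) 2 (vol Ω) := fun i => memLp_of_eLpNorm_sub_lt_top
      (continuous_pd (hU n) i).aestronglyMeasurable (Lp.memLp (grad i x))
      ((k2 i).trans ENNReal.ofReal_lt_top)
    have m3 : MemLp (U n) 2 (surf Ω) := memLp_of_eLpNorm_sub_lt_top
      (hU n).continuous.aestronglyMeasurable (Lp.memLp (tr x)) (k3.trans ENNReal.ofReal_lt_top)
    refine ⟨triple (m1.toLp _) (fun i => (m2 i).toLp _) (m3.toLp _),
      ⟨U n, hU n, m1.coeFn_toLp, fun i => (m2 i).coeFn_toLp, m3.coeFn_toLp⟩, ?_⟩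
    rw [dist_eq_norm]
    refine lt_of_pow_lt_pow_left₀ 2 hε.le ?_
    rw [graph_norm_sq]
    simp only [map_sub, val_triple, grad_triple, tr_triple]
    have b1 := pow_lt_pow_left₀ (norm_sub_toLp_lt _ m1 hε3 k1) (norm_nonneg _) two_ne_zero
    have b2 := fun i => pow_lt_pow_left₀ (norm_sub_toLp_lt _ (m2 i) hε3 (k2 i)) (norm_nonneg _)
      two_ne_zero
    have b3 := pow_lt_pow_left₀ (norm_sub_toLp_lt _ m3 hε3 k3) (norm_nonneg _) two_ne_zero
    rw [Fin.sum_univ_three]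
    have := b2 0
    have := b2 1
    have := b2 2
    have : 0 < ε ^ 2 := by positivity
    linarith [div_pow ε 3 2]
  · intro hx
    obtain ⟨y, hy, hyx⟩ := mem_closure_iff_seq_limit.1 hx
    choose U hU h1 h2 h3 using hy
    have key : ∀ {μ : Measure E3} (P : GraphSpace Ω →L[ℝ] Lp ℍ[ℝ] 2 μ) (W : ℕ → E3 → ℍ[ℝ]),
        (∀ n, P (y n) =ᵐ[μ] W n) →
        Tendsto (fun n => eLpNorm (fun z => W n z - P x z) 2 μ) atTop (𝓝 0) := by
      intro μ P W hW
      have h := tendsto_iff_edist_tendsto_0.1 ((P.continuous.tendsto x).comp hyx)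
      refine h.congr fun n => ?_
      rw [Function.comp_apply, Lp.edist_def]
      refine eLpNorm_congr_ae ?_
      filter_upwards [hW n] with z hz
      rw [Pi.sub_apply, hz]
    exact ⟨Lp.memLp _, U, hU, key val U h1, fun i => key (grad i) _ fun n => h2 n i, key tr U h3⟩

/-! ### Integrals against test functions -/

/-- Integration against a square integrable real function. -/
def testInt {ψ : E3 → ℝ} (hψ : MemLp ψ 2 (vol Ω)) : V Ω →L[ℝ] ℍ[ℝ] :=
  (ContinuousLinearMap.lsmul ℝ ℝ).lpPairing (vol Ω) 2 2 (hψ.toLp ψ)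

theorem testInt_apply {ψ : E3 → ℝ} (hψ : MemLp ψ 2 (vol Ω)) (f : V Ω) :
    testInt hψ f = ∫ x in Ω, ψ x • f x := by
  rw [testInt, ContinuousLinearMap.lpPairing_eq_integral]
  refine integral_congr_ae ?_
  filter_upwards [hψ.coeFn_toLp] with x hx
  simp [hx]

theorem testInt_op_smul {ψ : E3 → ℝ} (hψ : MemLp ψ 2 (vol Ω)) (c : ℍ[ℝ]) (f : V Ω) :
    testInt hψ (MulOpposite.op c • f) = testInt hψ f * c := by
  have hi : Integrable (fun x => ψ x • f x) (vol Ω) := 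
    memLp_one_iff_integrable.1 ((Lp.memLp f).smul hψ)
  rw [testInt_apply, testInt_apply, ← integral_mul_const_of_integrable hi]
  refine integral_congr_ae ?_
  filter_upwards [coeFn_op_smul c f] with x hx
  rw [hx, smul_mul_assoc]

theorem IsTest.memLp {φ : E3 → ℝ} (hφ : IsTest Ω φ) : MemLp φ 2 (vol Ω) :=
  (hφ.contDiff.continuous.memLp_of_hasCompactSupport hφ.hasCompactSupport).restrict Ω

theorem IsTest.memLp_pd {φ : E3 → ℝ} (hφ : IsTest Ω φ) (i : Fin 3) : MemLp (pd i φ) 2 (vol Ω) :=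
  ((continuous_pd hφ.contDiff i).memLp_of_hasCompactSupport
    (hφ.hasCompactSupport.fderiv_apply ℝ _)).restrict Ω

/-- The mean zero space `𝓗`, as a space of triples. -/
def meanZeroH1 (Ω : Set E3) [IsFiniteMeasure (vol Ω)] : Submodule ℝ (GraphSpace Ω) :=
  (smoothGraph Ω).topologicalClosure ⊓
    (⨅ i : Fin 3, ⨅ φ : {φ : E3 → ℝ // IsTest Ω φ},
      (testInt φ.2.memLp ∘L grad i + testInt (φ.2.memLp_pd i) ∘L val).ker) ⊓
    (testInt (memLp_const (1 : ℝ)) ∘L val).ker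

variable [IsFiniteMeasure (vol Ω)]

theorem mem_meanZeroH1 (x : GraphSpace Ω) :
    x ∈ meanZeroH1 Ω ↔ IsMeanZeroH1 Ω (val x) (fun i => grad i x) (tr x) := by
  simp only [meanZeroH1, Submodule.mem_inf, Submodule.mem_iInf, Subtype.forall,
    ← isTrace_iff_mem_closure]
  simp only [LinearMap.mem_ker, ContinuousLinearMap.coe_coe, add_apply,
    ContinuousLinearMap.comp_apply, testInt_apply, one_smul, add_eq_zero_iff_eq_neg]
  exact ⟨fun h => ⟨⟨Lp.memLp _, fun i => Lp.memLp _, h.1.2⟩, h.1.1, h.2⟩,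
    fun h => ⟨⟨h.isTrace, h.isH1.weak_deriv⟩, h.mean_zero⟩⟩

/-- Each defining condition is a closure or the kernel of a continuous map; closedness supplies the
completeness used by Lax–Milgram. -/
theorem isClosed_meanZeroH1 : IsClosed (meanZeroH1 Ω : Set (GraphSpace Ω)) := by
  simp only [meanZeroH1, Submodule.coe_inf, Submodule.coe_iInf]
  exact ((Submodule.isClosed_topologicalClosure _).inter
    (isClosed_iInter fun i => isClosed_iInter fun φ => ContinuousLinearMap.isClosed_ker _)).inter
    (ContinuousLinearMap.isClosed_ker _)

theorem op_smul_mem_meanZeroH1 (c : ℍ[ℝ]) {x : GraphSpace Ω} (hx : x ∈ meanZeroH1 Ω) :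
    MulOpposite.op c • x ∈ meanZeroH1 Ω := by
  simp only [meanZeroH1, Submodule.mem_inf, Submodule.mem_iInf, LinearMap.mem_ker,
    ContinuousLinearMap.coe_coe, add_apply, ContinuousLinearMap.comp_apply,
    val_op_smul, grad_op_smul, testInt_op_smul] at hx ⊢
  refine ⟨⟨op_smul_mem_closure_smoothGraph c hx.1.1, fun i φ => ?_⟩, ?_⟩
  · rw [← add_mul, hx.1.2 i φ, zero_mul]
  · rw [hx.2, zero_mul]

end Graph

/-! ### The trace and Poincaré inequalities for quaternionic functions -/

section Components

variable {Ω : Set E3}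

/-- Applied to the four real components, as the trace and Poincaré constants are given for real
functions. -/
theorem IsH1.clm_comp {F F' : Type*} [NormedAddCommGroup F] [NormedSpace ℝ F] [CompleteSpace F]
    [NormedAddCommGroup F'] [NormedSpace ℝ F'] [CompleteSpace F'] (L : F →L[ℝ] F') {u : E3 → F}
    {Du : Fin 3 → E3 → F} (h : IsH1 Ω u Du) :
    IsH1 Ω (fun x => L (u x)) (fun i x => L (Du i x)) where
  memLp := L.comp_memLp' h.memLp
  memLp_deriv i := L.comp_memLp' (h.memLp_deriv i)
  weak_deriv i φ hφ := by
    have h1 : Integrable (fun x => φ x • Du i x) (vol Ω) :=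
      memLp_one_iff_integrable.1 ((h.memLp_deriv i).smul hφ.memLp)
    have h2 : Integrable (fun x => pd i φ x • u x) (vol Ω) :=
      memLp_one_iff_integrable.1 (h.memLp.smul (hφ.memLp_pd i))
    simp_rw [← map_smul]
    rw [L.integral_comp_comm h1, L.integral_comp_comm h2, h.weak_deriv i φ hφ, map_neg]

theorem tendsto_eLpNorm_clm_comp {F F' : Type*} [NormedAddCommGroup F] [NormedSpace ℝ F]
    [NormedAddCommGroup F'] [NormedSpace ℝ F'] (L : F →L[ℝ] F') {μ : Measure E3} {w : ℕ → E3 → F}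
    (h : Tendsto (fun n => eLpNorm (w n) 2 μ) atTop (𝓝 0)) :
    Tendsto (fun n => eLpNorm (fun x => L (w n x)) 2 μ) atTop (𝓝 0) := by
  have h' : Tendsto (fun n => ENNReal.ofReal ‖L‖ * eLpNorm (w n) 2 μ) atTop (𝓝 0) := by
    simpa using ENNReal.Tendsto.const_mul (a := ENNReal.ofReal ‖L‖) h
      (Or.inr ENNReal.ofReal_ne_top)
  exact tendsto_of_tendsto_of_tendsto_of_le_of_le tendsto_const_nhds h' (fun _ => zero_le)
    fun n => eLpNorm_le_mul_eLpNorm_of_ae_le_mul (Eventually.of_forall fun x => L.le_opNorm _) 2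

theorem IsTrace.clm_comp {F F' : Type*} [NormedAddCommGroup F] [NormedSpace ℝ F]
    [NormedAddCommGroup F'] [NormedSpace ℝ F'] (L : F →L[ℝ] F') {u : E3 → F}
    {Du : Fin 3 → E3 → F} {g : E3 → F} (h : IsTrace Ω u Du g) :
    IsTrace Ω (fun x => L (u x)) (fun i x => L (Du i x)) (fun x => L (g x)) := by
  obtain ⟨hg, U, hU, h1, h2, h3⟩ := h
  refine ⟨L.comp_memLp' hg, fun n x => L (U n x), fun n => L.contDiff.comp (hU n), ?_,
    fun i => ?_, ?_⟩
  · simpa only [map_sub] using tendsto_eLpNorm_clm_comp L h1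
  · simpa only [map_sub, pd_clm_comp L (hU _)] using tendsto_eLpNorm_clm_comp L (h2 i)
  · simpa only [map_sub] using tendsto_eLpNorm_clm_comp L h3

/-- The real components of a quaternion. -/
def component (c : Fin 4) : ℍ[ℝ] →L[ℝ] ℝ :=
  (EuclideanSpace.proj c : EuclideanSpace ℝ (Fin 4) →L[ℝ] ℝ) ∘L
    (Quaternion.linearIsometryEquivTuple.toContinuousLinearEquiv :
      ℍ[ℝ] →L[ℝ] EuclideanSpace ℝ (Fin 4))

theorem norm_sq_eq_sum_component (q : ℍ[ℝ]) : ‖q‖ ^ 2 = ∑ c, ‖component c q‖ ^ 2 := by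
  rw [← Quaternion.linearIsometryEquivTuple.norm_map q, EuclideanSpace.norm_sq_eq]
  rfl

theorem eLpNorm_two_sq {F : Type*} [NormedAddCommGroup F] (f : E3 → F) (μ : Measure E3) :
    eLpNorm f 2 μ ^ 2 = ∫⁻ x, ‖f x‖ₑ ^ 2 ∂μ := by
  have := eLpNorm_nnreal_pow_eq_lintegral (f := f) (μ := μ) (p := 2) two_ne_zero
  simpa using this

theorem eLpNorm_sq_eq_sum_component {f : E3 → ℍ[ℝ]} {μ : Measure E3}
    (hf : AEStronglyMeasurable f μ) :
    eLpNorm f 2 μ ^ 2 = ∑ c, eLpNorm (fun x => component c (f x)) 2 μ ^ 2 := by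
  simp_rw [eLpNorm_two_sq]
  rw [← lintegral_finsetSum' _ fun c _ =>
    (((component c).continuous.comp_aestronglyMeasurable hf).enorm.pow_const 2)]
  refine lintegral_congr fun x => ?_
  have h : ∀ {F : Type} [NormedAddCommGroup F] (z : F), ‖z‖ₑ ^ 2 = ENNReal.ofReal (‖z‖ ^ 2) :=
    fun z => by rw [← ofReal_norm, ENNReal.ofReal_pow (norm_nonneg _)]
  simp_rw [h]
  rw [norm_sq_eq_sum_component, ENNReal.ofReal_sum_of_nonneg fun _ _ => by positivity]

theorem ofReal_Lp_norm_sq {F : Type*} [NormedAddCommGroup F] {μ : Measure E3} (f : Lp F 2 μ) :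
    ENNReal.ofReal (‖f‖ ^ 2) = eLpNorm f 2 μ ^ 2 := by
  rw [ENNReal.ofReal_pow (norm_nonneg _), ofReal_norm, Lp.enorm_def]

theorem rpow_half_sq (z : ℝ≥0∞) : (z ^ (1 / 2 : ℝ)) ^ 2 = z := by
  rw [← ENNReal.rpow_natCast, ← ENNReal.rpow_mul]
  norm_num

variable [IsFiniteMeasure (vol Ω)]

/-- Squared norms add over the real components, so the real constant survives unchanged. Each
component has mean zero, so nothing is subtracted in the Poincaré–Wirtinger inequality. -/
theorem norm_val_sq_le {CP : ℝ} (hCP : IsPoincareWirtingerConstant Ω CP) {x : GraphSpace Ω}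
    (hx : x ∈ meanZeroH1 Ω) : ‖val x‖ ^ 2 ≤ CP ^ 2 * ∑ i, ‖grad i x‖ ^ 2 := by
  have hx' := (mem_meanZeroH1 x).1 hx
  have hc : ∀ c, eLpNorm (fun y => component c (val x y)) 2 (vol Ω) ^ 2 ≤
      ENNReal.ofReal (CP ^ 2) *
        ∑ i, eLpNorm (fun y => component c (grad i x y)) 2 (vol Ω) ^ 2 := fun c => by
    have h := hCP.2 _ _ (hx'.isH1.clm_comp (component c))
    have h0 : ⨍ y in Ω, component c (val x y) = 0 := by
      rw [average_eq, (component c).integral_comp_comm ((Lp.memLp (val x)).integrable one_le_two),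
        hx'.mean_zero, map_zero, smul_zero]
    simp only [h0, sub_zero] at h
    have h2 := pow_le_pow_left' h 2
    rwa [mul_pow, gradNorm, rpow_half_sq, ← ENNReal.ofReal_pow hCP.1.le] at h2
  rw [← ENNReal.ofReal_le_ofReal_iff (by positivity), ENNReal.ofReal_mul (by positivity),
    ENNReal.ofReal_sum_of_nonneg fun _ _ => by positivity]
  simp_rw [ofReal_Lp_norm_sq, eLpNorm_sq_eq_sum_component (Lp.aestronglyMeasurable _)]
  rw [Finset.sum_comm, Finset.mul_sum]
  exact Finset.sum_le_sum fun c _ => hc c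

theorem norm_tr_sq_le {C : ℝ} (hC : IsTraceConstant Ω C) {x : GraphSpace Ω}
    (hx : x ∈ meanZeroH1 Ω) :
    ‖tr x‖ ^ 2 ≤ C ^ 2 * (‖val x‖ ^ 2 + ∑ i, ‖grad i x‖ ^ 2) := by
  have hx' := (mem_meanZeroH1 x).1 hx
  have hc : ∀ c, eLpNorm (fun y => component c (tr x y)) 2 (surf Ω) ^ 2 ≤
      ENNReal.ofReal (C ^ 2) * (eLpNorm (fun y => component c (val x y)) 2 (vol Ω) ^ 2 +
        ∑ i, eLpNorm (fun y => component c (grad i x y)) 2 (vol Ω) ^ 2) := fun c => by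
    have h := hC.2 _ _ _ (hx'.isH1.clm_comp (component c)) (hx'.isTrace.clm_comp (component c))
    have h2 := pow_le_pow_left' h 2
    rw [mul_pow, hHalfNorm, h1Norm, rpow_half_sq, rpow_half_sq, ← ENNReal.ofReal_pow hC.1.le,
      ← eLpNorm_two_sq] at h2
    -- Only the `L²(∂Ω)` part of the `H^{1/2}` norm is kept.
    exact le_self_add.trans h2
  rw [← ENNReal.ofReal_le_ofReal_iff (by positivity), ENNReal.ofReal_mul (by positivity),
    ENNReal.ofReal_add (by positivity) (by positivity),
    ENNReal.ofReal_sum_of_nonneg fun _ _ => by positivity]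
  simp_rw [ofReal_Lp_norm_sq, eLpNorm_sq_eq_sum_component (Lp.aestronglyMeasurable _)]
  rw [Finset.sum_comm, ← Finset.sum_add_distrib, Finset.mul_sum]
  exact Finset.sum_le_sum fun c _ => hc c

end Components

/-! ### The quaternionic inner product of `L²` -/

section Pairing

variable {μ : Measure E3}

/-- Quaternionic conjugation as a real linear map. -/
def starCLM : ℍ[ℝ] →L[ℝ] ℍ[ℝ] :=
  LinearMap.mkContinuous
    { toFun := star
      map_add' := star_add
      map_smul' := fun r q => by simp [Quaternion.star_smul] } 1 fun q => by simp

/-- The quaternionic inner product `∫ p̄ q` of `L²`. -/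
def qpair (μ : Measure E3) : Lp ℍ[ℝ] 2 μ →L[ℝ] Lp ℍ[ℝ] 2 μ →L[ℝ] ℍ[ℝ] :=
  (ContinuousLinearMap.mul ℝ ℍ[ℝ] ∘L starCLM).lpPairing μ 2 2

theorem qpair_apply (p q : Lp ℍ[ℝ] 2 μ) : qpair μ p q = ∫ x, star (p x) * q x ∂μ := by
  rw [qpair, ContinuousLinearMap.lpPairing_eq_integral]
  rfl

theorem re_qpair (p q : Lp ℍ[ℝ] 2 μ) : (qpair μ p q).re = inner ℝ p q := by
  rw [qpair_apply, re_integral_star_mul]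

theorem qpair_op_smul (p q : Lp ℍ[ℝ] 2 μ) (c : ℍ[ℝ]) :
    qpair μ p (MulOpposite.op c • q) = qpair μ p q * c := by
  rw [qpair_apply, qpair_apply, integral_star_mul_op_smul]

end Pairing

/-! ### The coefficients -/

section Coefficients

variable {Ω : Set E3} {a : Fin 3 → E3 → ℝ} {b : E3 → ℝ}

/-- The coefficient `a_l²`. -/
def coefA (a : Fin 3 → E3 → ℝ) (l : Fin 3) (x : E3) : ℍ[ℝ] := ((a l x ^ 2 : ℝ) : ℍ[ℝ])

/-- The coefficient `a_l ∂_l a_l`. -/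
def coefD (a : Fin 3 → E3 → ℝ) (l : Fin 3) (x : E3) : ℍ[ℝ] := ((a l x * pd l (a l) x : ℝ) : ℍ[ℝ])

/-- The coefficient of `∂_i u` in the first order terms of the form. -/
def coefW (a : Fin 3 → E3 → ℝ) (i : Fin 3) (x : E3) : ℍ[ℝ] :=
  ∑ l, (a l x * pd l (a i) x) • (if l = i then 1 else e l * e i)

/-- The coefficient of `∂_l u` in `T u`. -/
def coefT (a : Fin 3 → E3 → ℝ) (l : Fin 3) (x : E3) : ℍ[ℝ] := a l x • e l

/-- The boundary coefficient. -/
def coefB (b : E3 → ℝ) (x : E3) : ℍ[ℝ] := (b x : ℍ[ℝ])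

/-- All the coefficients are essentially bounded. -/
structure BoundedCoef (Ω : Set E3) (a : Fin 3 → E3 → ℝ) (b : E3 → ℝ) : Prop where
  A : ∀ l, MemLp (coefA a l) ∞ (vol Ω)
  D : ∀ l, MemLp (coefD a l) ∞ (vol Ω)
  W : ∀ i, MemLp (coefW a i) ∞ (vol Ω)
  T : ∀ l, MemLp (coefT a l) ∞ (vol Ω)
  B : MemLp (coefB b) ∞ (surf Ω)

theorem memLp_top_of_continuousOn {μ : Measure E3} {K S : Set E3} (hK : IsCompact K)
    (hS : MeasurableSet S) (hSK : S ⊆ K) {f : E3 → ℝ} (hf : ContinuousOn f K) :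
    MemLp f ∞ (μ.restrict S) := by
  obtain ⟨C, hC⟩ := hK.exists_bound_of_continuousOn hf
  exact memLp_top_of_bound ((hf.mono hSK).aestronglyMeasurable hS) C
    ((ae_restrict_mem hS).mono fun x hx => hC x (hSK hx))

theorem IsBoundedC1Domain.isCompact_closure (hΩ : IsBoundedC1Domain Ω) : IsCompact (closure Ω) :=
  hΩ.isBounded.isCompact_closure

theorem IsBoundedC1Domain.isCompact_frontier (hΩ : IsBoundedC1Domain Ω) : IsCompact (frontier Ω) :=
  hΩ.isCompact_closure.of_isClosed_subset isClosed_frontier frontier_subset_closure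

theorem IsBoundedC1Domain.isFiniteMeasure (hΩ : IsBoundedC1Domain Ω) : IsFiniteMeasure (vol Ω) :=
  isFiniteMeasure_restrict.2 hΩ.isBounded.measure_lt_top.ne

theorem IsC1Closure.memLp (hΩ : IsBoundedC1Domain Ω) {f : E3 → ℝ} (hf : IsC1Closure Ω f) :
    MemLp f ∞ (vol Ω) :=
  memLp_top_of_continuousOn hΩ.isCompact_closure hΩ.isOpen.measurableSet subset_closure
    hf.continuousOn

theorem IsC1Closure.exists_continuousOn_pd {f : E3 → ℝ} (hf : IsC1Closure Ω f) (l : Fin 3) :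
    ∃ g : E3 → ℝ, ContinuousOn g (closure Ω) ∧ ∀ x ∈ Ω, pd l f x = g x := by
  obtain ⟨G, hG, hGf⟩ := hf.extends_deriv
  exact ⟨fun x => G x (EuclideanSpace.single l 1), hG.clm_apply continuousOn_const,
    fun x hx => by rw [pd, hGf x hx]⟩

theorem IsC1Closure.memLp_pd (hΩ : IsBoundedC1Domain Ω) {f : E3 → ℝ} (hf : IsC1Closure Ω f)
    (l : Fin 3) : MemLp (pd l f) ∞ (vol Ω) := by
  obtain ⟨g, hg, hgf⟩ := hf.exists_continuousOn_pd l
  refine (memLp_top_of_continuousOn hΩ.isCompact_closure hΩ.isOpen.measurableSet subset_closure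
    hg).ae_eq ?_
  filter_upwards [ae_restrict_mem hΩ.isOpen.measurableSet] with x hx
  exact (hgf x hx).symm

/-- A real `⨆` bounds its terms only when the family is bounded above; here compactness of the
closure provides the bound. -/
theorem bddAbove_coef (hΩ : IsBoundedC1Domain Ω) (ha : ∀ l, IsC1Closure Ω (a l)) (i l : Fin 3) :
    BddAbove (Set.range fun x : Ω => |a l x * pd l (a i) x|) := by
  obtain ⟨g, hg, hgf⟩ := (ha i).exists_continuousOn_pd l
  obtain ⟨C, hC⟩ := hΩ.isCompact_closure.exists_bound_of_continuousOn
    ((ha l).continuousOn.mul hg)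
  refine ⟨C, ?_⟩
  rintro _ ⟨x, rfl⟩
  simpa [hgf x x.2] using hC x (subset_closure x.2)

theorem coe_eq_smul_one (r : ℝ) : (r : ℍ[ℝ]) = r • (1 : ℍ[ℝ]) := by
  ext <;> simp

theorem memLp_top_smul_const {μ : Measure E3} {f : E3 → ℝ} (hf : MemLp f ∞ μ) (c : ℍ[ℝ]) :
    MemLp (fun x => f x • c) ∞ μ :=
  ((ContinuousLinearMap.id ℝ ℝ).smulRight c).comp_memLp' hf

theorem boundedCoef (hΩ : IsBoundedC1Domain Ω) (hb : ContinuousOn b (frontier Ω))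
    (ha : ∀ l, IsC1Closure Ω (a l)) : BoundedCoef Ω a b := by
  have hm : ∀ {f g : E3 → ℝ}, MemLp f ∞ (vol Ω) → MemLp g ∞ (vol Ω) →
      MemLp (fun x => f x * g x) ∞ (vol Ω) := fun hf hg => hg.mul hf
  refine ⟨fun l => ?_, fun l => ?_, fun i => ?_, fun l => ?_, ?_⟩
  · change MemLp (fun x => ((a l x ^ 2 : ℝ) : ℍ[ℝ])) ∞ (vol Ω)
    simp only [coe_eq_smul_one, sq]
    exact memLp_top_smul_const (hm ((ha l).memLp hΩ) ((ha l).memLp hΩ)) 1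
  · change MemLp (fun x => ((a l x * pd l (a l) x : ℝ) : ℍ[ℝ])) ∞ (vol Ω)
    simp only [coe_eq_smul_one]
    exact memLp_top_smul_const (hm ((ha l).memLp hΩ) ((ha l).memLp_pd hΩ l)) 1
  · exact memLp_finsetSum _ fun l _ =>
      memLp_top_smul_const (hm ((ha l).memLp hΩ) ((ha i).memLp_pd hΩ l)) _
  · exact memLp_top_smul_const ((ha l).memLp hΩ) _
  · change MemLp (fun x => (b x : ℍ[ℝ])) ∞ (surf Ω)
    simp only [coe_eq_smul_one]
    exact memLp_top_smul_const (memLp_top_of_continuousOn hΩ.isCompact_frontier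
      isClosed_frontier.measurableSet subset_rfl hb) 1

theorem norm_e (l : Fin 3) : ‖e l‖ = 1 := by
  have h : ‖e l‖ ^ 2 = 1 := by
    rw [sq, ← Quaternion.normSq_eq_norm_mul_self, Quaternion.normSq_def']
    fin_cases l <;> simp [e]
  exact (pow_eq_one_iff_of_nonneg (norm_nonneg _) two_ne_zero).1 h

/-- The diagonal terms `½ ∂_l (a_l²) = a_l ∂_l a_l` fill the gap `l = i` left by the vector part. As
`1` and `e_l e_i` have norm one, summing these bounds over `i` gives exactly `constT'`. -/
theorem norm_coefW_le (hΩ : IsBoundedC1Domain Ω) (ha : ∀ l, IsC1Closure Ω (a l)) (i : Fin 3) :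
    ∀ᵐ x ∂(vol Ω), ‖coefW a i x‖ ≤ ∑ l, ⨆ x : Ω, |a l x * pd l (a i) x| := by
  filter_upwards [ae_restrict_mem hΩ.isOpen.measurableSet] with x hx
  refine (norm_sum_le _ _).trans (Finset.sum_le_sum fun l _ => ?_)
  have h : ‖(if l = i then (1 : ℍ[ℝ]) else e l * e i)‖ = 1 := by
    split_ifs <;> simp [norm_e]
  rw [norm_smul, h, mul_one, Real.norm_eq_abs]
  exact le_ciSup (bddAbove_coef hΩ ha i l) ⟨x, hx⟩

theorem norm_coefB_le (hΩ : IsBoundedC1Domain Ω) (hb : ContinuousOn b (frontier Ω)) :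
    ∀ᵐ x ∂(surf Ω), ‖coefB b x‖ ≤ ⨆ x : frontier Ω, |b x| := by
  filter_upwards [ae_restrict_mem isClosed_frontier.measurableSet] with x hx
  obtain ⟨C, hC⟩ := hΩ.isCompact_frontier.exists_bound_of_continuousOn hb
  rw [coefB, Quaternion.norm_coe, Real.norm_eq_abs]
  refine le_ciSup (f := fun x : frontier Ω => |b x|) ⟨C, ?_⟩ ⟨x, hx⟩
  rintro _ ⟨y, rfl⟩
  exact hC y y.2

theorem constT_le (l : Fin 3) {x : E3} (hx : x ∈ Ω) : constT Ω a ≤ a l x ^ 2 := by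
  refine (ciInf_le (Set.finite_range _).bddBelow l).trans
    (ciInf_le (f := fun x : Ω => a l x ^ 2) ⟨0, ?_⟩ ⟨x, hx⟩)
  rintro _ ⟨y, rfl⟩
  positivity

theorem constT'_nonneg : 0 ≤ constT' Ω a :=
  Finset.sum_nonneg fun _ _ => Finset.sum_nonneg fun _ _ => Real.iSup_nonneg fun _ => abs_nonneg _

/-! ### The form -/

/-- The first order terms of the form and the vector part of `Q_s(T)`. -/
def lowerTerms (h : BoundedCoef Ω a b) : GraphSpace Ω →L[ℝ] V Ω := ∑ i, lmul (h.W i) ∘L grad i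

theorem lowerTerms_apply (h : BoundedCoef Ω a b) (x : GraphSpace Ω) :
    lowerTerms h x = ∑ i, lmul (h.W i) (grad i x) := by
  simp [lowerTerms]

/-- The real part of the form of `Q_s(T)`, for `Re s = 0`, without the term with `|s|²`. -/
def robinForm (h : BoundedCoef Ω a b) : GraphSpace Ω →L[ℝ] GraphSpace Ω →L[ℝ] ℝ :=
  ∑ l, (innerBilin (V Ω)).bilinearComp (lmul (h.A l) ∘L grad l) (grad l) +
    (innerBilin (V Ω)).bilinearComp (lowerTerms h) val +
    (innerBilin (Lp ℍ[ℝ] 2 (surf Ω))).bilinearComp (lmul h.B ∘L tr) tr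

theorem robinForm_apply (h : BoundedCoef Ω a b) (x y : GraphSpace Ω) :
    robinForm h x y = ∑ l, inner ℝ (lmul (h.A l) (grad l x)) (grad l y) +
      inner ℝ (lowerTerms h x) (val y) + inner ℝ (lmul h.B (tr x)) (tr y) := by
  simp [robinForm]

/-- All coefficients act by left multiplication, which commutes with right scalars. -/
theorem robinForm_op_smul (h : BoundedCoef Ω a b) (c : ℍ[ℝ]) (x y : GraphSpace Ω) :
    robinForm h (MulOpposite.op c • x) y = robinForm h x (MulOpposite.op (star c) • y) := by
  simp only [robinForm_apply, lowerTerms_apply, grad_op_smul, tr_op_smul, val_op_smul,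
    lmul_op_smul, ← Finset.smul_sum, inner_op_smul]

theorem le_inner_lmul {μ : Measure E3} {f : E3 → ℝ} (hm : MemLp (fun x => (f x : ℍ[ℝ])) ∞ μ)
    {C : ℝ} (hC : ∀ᵐ x ∂μ, C ≤ f x) (u : Lp ℍ[ℝ] 2 μ) :
    C * ‖u‖ ^ 2 ≤ inner ℝ (lmul hm u) u := by
  rw [← real_inner_self_eq_norm_sq, L2.inner_def, L2.inner_def, ← integral_const_mul]
  refine integral_mono_ae ((L2.integrable_inner u u).const_mul C) (L2.integrable_inner _ u) ?_
  filter_upwards [hC, lmul_ae hm u] with x h1 h2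
  rw [h2, Quaternion.coe_mul_eq_smul, real_inner_smul_left]
  exact mul_le_mul_of_nonneg_right h1 real_inner_self_nonneg

variable [IsFiniteMeasure (vol Ω)]

/-- Each of the three terms is compared with `‖∇u‖²`: the first by the pointwise bound on `a_l²`,
the second by Cauchy–Schwarz and Poincaré, the third by the trace inequality followed by Poincaré.
-/
theorem robinForm_self_ge (hΩ : IsBoundedC1Domain Ω) (hb : ContinuousOn b (frontier Ω))
    (ha : ∀ l, IsC1Closure Ω (a l)) {Ctr CP : ℝ} (hCtr : IsTraceConstant Ω Ctr)
    (hCP : IsPoincareWirtingerConstant Ω CP) (h : BoundedCoef Ω a b) {x : GraphSpace Ω}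
    (hx : x ∈ meanZeroH1 Ω) :
    (constT Ω a - constT' Ω a * CP - constK Ω b Ctr * (1 + CP ^ 2)) * ∑ i, ‖grad i x‖ ^ 2 ≤
      robinForm h x x := by
  set G := ∑ i, ‖grad i x‖ ^ 2 with hG
  have hG0 : 0 ≤ G := by positivity
  have hP := norm_val_sq_le hCP hx
  have hT := norm_tr_sq_le hCtr hx
  rw [← hG] at hP hT
  have hP' : ‖val x‖ ≤ CP * √G := by
    rw [← Real.sqrt_sq hCP.1.le, ← Real.sqrt_mul (by positivity)]
    exact Real.le_sqrt_of_sq_le hP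
  have hD : ∀ i, ‖grad i x‖ ≤ √G := fun i => Real.le_sqrt_of_sq_le
    (Finset.single_le_sum (f := fun i => ‖grad i x‖ ^ 2) (fun _ _ => by positivity)
      (Finset.mem_univ i))
  have h1 : constT Ω a * G ≤ ∑ l, inner ℝ (lmul (h.A l) (grad l x)) (grad l x) := by
    rw [hG, Finset.mul_sum]
    refine Finset.sum_le_sum fun l _ => le_inner_lmul (h.A l) ?_ (grad l x)
    filter_upwards [ae_restrict_mem hΩ.isOpen.measurableSet] with y hy
    exact constT_le l hy
  have h2 : -(constT' Ω a * CP * G) ≤ inner ℝ (lowerTerms h x) (val x) := by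
    have hW : ‖lowerTerms h x‖ ≤ constT' Ω a * √G := by
      rw [lowerTerms_apply, constT', Finset.sum_mul]
      refine (norm_sum_le _ _).trans (Finset.sum_le_sum fun i _ => ?_)
      refine (norm_lmul_le (h.W i) (norm_coefW_le hΩ ha i) _).trans ?_
      have := Finset.sum_nonneg fun l (_ : l ∈ Finset.univ) =>
        Real.iSup_nonneg fun x : Ω => abs_nonneg (a l x * pd l (a i) x)
      gcongr
      exact hD i
    have hT'0 := constT'_nonneg (Ω := Ω) (a := a)
    have hi := neg_le_of_abs_le (abs_real_inner_le_norm (lowerTerms h x) (val x))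
    have hmul : ‖lowerTerms h x‖ * ‖val x‖ ≤ constT' Ω a * √G * (CP * √G) := by gcongr
    have hs : constT' Ω a * √G * (CP * √G) = constT' Ω a * CP * G := by
      rw [mul_mul_mul_comm, Real.mul_self_sqrt hG0]
    linarith
  have h3 : -(constK Ω b Ctr * (1 + CP ^ 2) * G) ≤ inner ℝ (lmul h.B (tr x)) (tr x) := by
    have hi := neg_le_of_abs_le (abs_real_inner_le_norm (lmul h.B (tr x)) (tr x))
    have hB := norm_lmul_le h.B (norm_coefB_le hΩ hb) (tr x)
    set β := ⨆ x : frontier Ω, |b x| with hβ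
    have hβ0 : 0 ≤ β := Real.iSup_nonneg fun _ => abs_nonneg _
    have hmul : ‖lmul h.B (tr x)‖ * ‖tr x‖ ≤ constK Ω b Ctr * (1 + CP ^ 2) * G := calc
      _ ≤ β * ‖tr x‖ * ‖tr x‖ := by gcongr
      _ = β * ‖tr x‖ ^ 2 := by ring
      _ ≤ β * (Ctr ^ 2 * (CP ^ 2 * G + G)) := by
        gcongr
        exact hT.trans (by gcongr)
      _ = _ := by rw [constK, ← hβ]; ring
    linarith
  rw [robinForm_apply]
  linarith

end Coefficients

/-! ### Weak solutions as solutions of a variational equation -/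

section WeakSol

variable {Ω : Set E3} {a : Fin 3 → E3 → ℝ} {b : E3 → ℝ}

/-- Weak solutions are stated for functions and triples consist of almost everywhere classes; this
and the next lemma pass between them. -/
theorem IsMeanZeroH1.congr_ae {u u' : E3 → ℍ[ℝ]} {Du Du' : Fin 3 → E3 → ℍ[ℝ]} {g g' : E3 → ℍ[ℝ]}
    (h : IsMeanZeroH1 Ω u Du g) (hu : u =ᵐ[vol Ω] u') (hDu : ∀ i, Du i =ᵐ[vol Ω] Du' i)
    (hg : g =ᵐ[surf Ω] g') : IsMeanZeroH1 Ω u' Du' g' := by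
  refine ⟨⟨h.isH1.memLp.ae_eq hu, fun i => (h.isH1.memLp_deriv i).ae_eq (hDu i),
    fun i φ hφ => ?_⟩, ?_, ?_⟩
  · have h1 := integral_congr_ae ((hDu i).mono fun x hx => congrArg (φ x • ·) hx)
    have h2 := integral_congr_ae (hu.mono fun x hx => congrArg (pd i φ x • ·) hx)
    exact h1.symm.trans ((h.isH1.weak_deriv i φ hφ).trans (congrArg _ h2))
  · obtain ⟨m, U, hU, h1, h2, h3⟩ := h.isTrace
    refine ⟨m.ae_eq hg, U, hU, h1.congr fun n => ?_, fun i => (h2 i).congr fun n => ?_,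
      h3.congr fun n => ?_⟩
    · exact eLpNorm_congr_ae (hu.mono fun x hx => congrArg (U n x - ·) hx)
    · exact eLpNorm_congr_ae ((hDu i).mono fun x hx => congrArg (pd i (U n) x - ·) hx)
    · exact eLpNorm_congr_ae (hg.mono fun x hx => congrArg (U n x - ·) hx)
  · rw [← integral_congr_ae hu, h.mean_zero]

theorem formQ_congr_ae {s : ℍ[ℝ]} {u u' v v' g g' k k' : E3 → ℍ[ℝ]}
    {Du Du' Dv Dv' : Fin 3 → E3 → ℍ[ℝ]}
    (hu : u =ᵐ[vol Ω] u') (hDu : ∀ i, Du i =ᵐ[vol Ω] Du' i) (hg : g =ᵐ[surf Ω] g')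
    (hv : v =ᵐ[vol Ω] v') (hDv : ∀ i, Dv i =ᵐ[vol Ω] Dv' i) (hk : k =ᵐ[surf Ω] k') :
    formQ Ω a b s u Du g v Dv k = formQ Ω a b s u' Du' g' v' Dv' k' := by
  have hDu' := eventually_all.2 hDu
  have hDv' := eventually_all.2 hDv
  unfold formQ
  congr 1
  · congr 1
    · congr 1
      · congr 1
        · refine Finset.sum_congr rfl fun l _ => integral_congr_ae ?_
          filter_upwards [hDu l, hDv l] with x h1 h2
          rw [h1, h2]
        · congr 1
          refine Finset.sum_congr rfl fun l _ => integral_congr_ae ?_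
          filter_upwards [hDu l, hv] with x h1 h2
          rw [h1, h2]
      · refine integral_congr_ae ?_
        filter_upwards [hDu', hv] with x h1 h2
        simp only [vectQ, h1, h2]
    · refine integral_congr_ae ?_
      filter_upwards [hg, hk] with x h1 h2
      rw [h1, h2]
  · congr 1
    refine integral_congr_ae ?_
    filter_upwards [hu, hv] with x h1 h2
    rw [h1, h2]

/-- The quaternionic form of `Q_s(T)` for `Re s = 0` and `|s|² = r`. -/
def robinPair (h : BoundedCoef Ω a b) (r : ℝ) (x y : GraphSpace Ω) : ℍ[ℝ] :=
  ∑ l, qpair (vol Ω) (lmul (h.A l) (grad l x)) (grad l y) + qpair (vol Ω) (lowerTerms h x) (val y) +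
    qpair (surf Ω) (lmul h.B (tr x)) (tr y) + r • qpair (vol Ω) (val x) (val y)

theorem re_robinPair (h : BoundedCoef Ω a b) (r : ℝ) (x y : GraphSpace Ω) :
    (robinPair h r x y).re = robinForm h x y + r * inner ℝ (val x) (val y) := by
  have hsum : ∀ f : Fin 3 → ℍ[ℝ], (∑ l, f l).re = ∑ l, (f l).re := fun f => by
    simp [Fin.sum_univ_three]
  simp only [robinPair, Quaternion.re_add, Quaternion.re_smul, hsum, re_qpair, robinForm_apply,
    smul_eq_mul]

theorem robinPair_op_smul (h : BoundedCoef Ω a b) (r : ℝ) (x y : GraphSpace Ω) (c : ℍ[ℝ]) :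
    robinPair h r x (MulOpposite.op c • y) = robinPair h r x y * c := by
  simp only [robinPair, grad_op_smul, val_op_smul, tr_op_smul, qpair_op_smul, add_mul,
    Finset.sum_mul, smul_mul_assoc]

theorem pd_sq {f : E3 → ℝ} {x : E3} (hf : DifferentiableAt ℝ f x) (l : Fin 3) :
    pd l (fun y => f y ^ 2) x = 2 * (f x * pd l f x) := by
  have h := (hf.hasFDerivAt.pow 2).fderiv
  simp only [pd]
  rw [h]
  simp
  ring

theorem formQ_eq_robinPair (hΩ : IsBoundedC1Domain Ω) (ha : ∀ l, IsC1Closure Ω (a l))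
    (h : BoundedCoef Ω a b) {s : ℍ[ℝ]} (hs : s.re = 0) (x y : GraphSpace Ω) :
    formQ Ω a b s (val x) (fun i => grad i x) (tr x) (val y) (fun i => grad i y) (tr y) =
      robinPair h (‖s‖ ^ 2) x y := by
  have e1 : ∀ l, ∫ z in Ω, star (a l z • grad l x z) * (a l z • grad l y z) =
      qpair (vol Ω) (lmul (h.A l) (grad l x)) (grad l y) := fun l => by
    rw [qpair_apply]
    refine integral_congr_ae ?_
    filter_upwards [lmul_ae (h.A l) (grad l x)] with z hz
    rw [hz, coefA, Quaternion.coe_mul_eq_smul, Quaternion.star_smul, Quaternion.star_smul,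
      smul_mul_smul_comm, smul_mul_assoc, sq]
  have e2 : ∀ l, ∫ z in Ω, star (grad l x z) * (pd l (fun y => a l y ^ 2) z • val y z) =
      (2 : ℝ) • qpair (vol Ω) (lmul (h.D l) (grad l x)) (val y) := fun l => by
    rw [qpair_apply, ← integral_smul]
    refine integral_congr_ae ?_
    filter_upwards [lmul_ae (h.D l) (grad l x), ae_restrict_mem hΩ.isOpen.measurableSet]
      with z hz hzΩ
    have hd : DifferentiableAt ℝ (a l) z :=
      ((ha l).contDiffOn.differentiableOn one_ne_zero).differentiableAt (hΩ.isOpen.mem_nhds hzΩ)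
    rw [hz, coefD, Quaternion.coe_mul_eq_smul, Quaternion.star_smul, pd_sq hd, mul_smul_comm,
      smul_mul_assoc, smul_smul]
  -- `lowerTerms` already contains the diagonal terms, absent from the vector part. Their
  -- subtraction here cancels against half of `e2`.
  have e3 : ∫ z in Ω, star (vectQ a s (fun i => grad i x) z) * val y z =
      qpair (vol Ω) (lowerTerms h x - ∑ l, lmul (h.D l) (grad l x)) (val y) := by
    rw [qpair_apply]
    refine integral_congr_ae ?_
    have hW := eventually_all.2 fun i => lmul_ae (h.W i) (grad i x)
    have hD := eventually_all.2 fun i => lmul_ae (h.D i) (grad i x)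
    have s1 := Lp.coeFn_finsetSum Finset.univ fun i => lmul (h.W i) (grad i x)
    have s2 := Lp.coeFn_finsetSum Finset.univ fun i => lmul (h.D i) (grad i x)
    rw [lowerTerms_apply]
    filter_upwards [hW, hD, Lp.coeFn_sub (∑ i, lmul (h.W i) (grad i x))
      (∑ i, lmul (h.D i) (grad i x)), s1, s2] with z h1 h2 h3 h4 h5
    rw [h3, Pi.sub_apply, h4, h5]
    congr 2
    simp only [vectQ, hs, mul_zero, zero_smul, sub_zero, Finset.sum_apply, h1, h2, coefW, coefD,
      Fin.sum_univ_three, Quaternion.coe_mul_eq_smul]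
    simp [add_mul]
    abel
  have e4 : ∫ z, b z • (star (tr x z) * tr y z) ∂(surf Ω) =
      qpair (surf Ω) (lmul h.B (tr x)) (tr y) := by
    rw [qpair_apply]
    refine integral_congr_ae ?_
    filter_upwards [lmul_ae h.B (tr x)] with z hz
    rw [hz, coefB, Quaternion.coe_mul_eq_smul, Quaternion.star_smul, smul_mul_assoc]
  simp only [formQ]
  rw [e3, e4, ← qpair_apply]
  simp only [e1, e2, robinPair, map_sub, map_sum, sub_apply, sum_apply, Finset.smul_sum, smul_smul]
  norm_num

/-- The inverse is determined by its weak solutions, so the choice made in `pseudoRes` is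
immaterial. -/
theorem pseudoRes_eq {s : ℍ[ℝ]} {R : V Ω →L[ℍ[ℝ]ᵐᵒᵖ] V Ω} (hR : IsInverseQ Ω a b s R) (F : V Ω) :
    pseudoRes Ω a b s F = R F := by
  have hex : ∃ R, IsInverseQ Ω a b s R := ⟨R, hR⟩
  rw [pseudoRes, dif_pos hex]
  exact ((hex.choose_spec F (R F)).1 ((hR F (R F)).2 rfl)).symm

variable [IsFiniteMeasure (vol Ω)]

theorem isWeakSol_iff (hΩ : IsBoundedC1Domain Ω) (ha : ∀ l, IsC1Closure Ω (a l))
    (h : BoundedCoef Ω a b) {s : ℍ[ℝ]} (hs : s.re = 0) (F u : V Ω) :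
    IsWeakSol Ω a b s F u ↔
      ∃ x, val x = u ∧ IsVarSol (meanZeroH1 Ω) (robinForm h) val ‖s‖ F x := by
  constructor
  · rintro ⟨Du, g, hM, hv⟩
    have cD := fun i => (hM.isH1.memLp_deriv i).coeFn_toLp
    have cg := hM.isTrace.1.coeFn_toLp
    refine ⟨triple u (fun i => (hM.isH1.memLp_deriv i).toLp (Du i)) (hM.isTrace.1.toLp g), rfl,
      (mem_meanZeroH1 _).2 (hM.congr_ae .rfl (fun i => (cD i).symm) cg.symm), fun y hy => ?_⟩
    have h1 := hv _ _ _ ((mem_meanZeroH1 y).1 hy)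
    rw [← re_robinPair, ← formQ_eq_robinPair hΩ ha h hs, ← re_qpair, qpair_apply, ← h1]
    exact congrArg _ (formQ_congr_ae .rfl cD cg .rfl (fun _ => .rfl) .rfl)
  · rintro ⟨x, rfl, hx, hsol⟩
    refine ⟨fun i => grad i x, tr x, (mem_meanZeroH1 x).1 hx, fun v Dv k hv => ?_⟩
    have cv := hv.isH1.memLp.coeFn_toLp
    have cD := fun i => (hv.isH1.memLp_deriv i).coeFn_toLp
    have ck := hv.isTrace.1.coeFn_toLp
    set y := triple (hv.isH1.memLp.toLp v) (fun i => (hv.isH1.memLp_deriv i).toLp (Dv i))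
      (hv.isTrace.1.toLp k) with hy
    have hyH : y ∈ meanZeroH1 Ω :=
      (mem_meanZeroH1 y).2 (hv.congr_ae cv.symm (fun i => (cD i).symm) ck.symm)
    have e1 : formQ Ω a b s (val x) (fun i => grad i x) (tr x) v Dv k =
        robinPair h (‖s‖ ^ 2) x y := by
      rw [← formQ_eq_robinPair hΩ ha h hs]
      exact formQ_congr_ae .rfl (fun _ => .rfl) .rfl cv.symm (fun i => (cD i).symm) ck.symm
    have e2 : ∫ z in Ω, star (F z) * v z = qpair (vol Ω) F (val y) := by
      rw [qpair_apply]
      exact integral_congr_ae (cv.symm.mono fun z hz => congrArg (star (F z) * ·) hz)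
    rw [e1, e2]
    -- Only the real part of the equation is known, but for all test functions; testing with `y`
    -- times `c` on the right gives the full equation.
    refine eq_of_re_mul_eq fun c => ?_
    rw [← robinPair_op_smul, re_robinPair, hsol _ (op_smul_mem_meanZeroH1 c hyH), ← qpair_op_smul,
      re_qpair, val_op_smul]

/-- Together with uniqueness this makes the solution operator right linear. -/
theorem isVarSol_op_smul {h : BoundedCoef Ω a b} {t : ℝ} {F : V Ω} {x : GraphSpace Ω}
    (hx : IsVarSol (meanZeroH1 Ω) (robinForm h) val t F x) (c : ℍ[ℝ]) :
    IsVarSol (meanZeroH1 Ω) (robinForm h) val t (MulOpposite.op c • F) (MulOpposite.op c • x) := by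
  refine ⟨op_smul_mem_meanZeroH1 c hx.1, fun y hy => ?_⟩
  rw [robinForm_op_smul, val_op_smul, inner_op_smul, inner_op_smul, ← val_op_smul]
  exact hx.2 _ (op_smul_mem_meanZeroH1 _ hy)

theorem robinForm_coercive (hΩ : IsBoundedC1Domain Ω) (hb : ContinuousOn b (frontier Ω))
    (ha : ∀ l, IsC1Closure Ω (a l)) {Ctr CP : ℝ} (hCtr : IsTraceConstant Ω Ctr)
    (hCP : IsPoincareWirtingerConstant Ω CP)
    (hcond : 0 < constT Ω a - constT' Ω a * CP - constK Ω b Ctr * (1 + CP ^ 2))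
    (h : BoundedCoef Ω a b) :
    ∃ δ > 0, ∀ x ∈ meanZeroH1 Ω, δ * ‖x‖ ^ 2 ≤ robinForm h x x := by
  set κ := constT Ω a - constT' Ω a * CP - constK Ω b Ctr * (1 + CP ^ 2)
  -- `M` is the constant in `‖x‖² ≤ M ‖∇u‖²` for the full norm of a triple: function, gradient and
  -- trace contribute one summand each.
  set M := CP ^ 2 + 1 + Ctr ^ 2 * (CP ^ 2 + 1) with hM
  have hM0 : 0 < M := by positivity
  refine ⟨κ / M, by positivity, fun x hx => le_trans ?_
    (robinForm_self_ge hΩ hb ha hCtr hCP h hx)⟩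
  have hP := norm_val_sq_le hCP hx
  have hT := norm_tr_sq_le hCtr hx
  rw [graph_norm_sq, div_mul_eq_mul_div, div_le_iff₀ hM0, mul_assoc]
  set G := ∑ i, ‖grad i x‖ ^ 2
  refine mul_le_mul_of_nonneg_left ?_ hcond.le
  have h1 : Ctr ^ 2 * (‖val x‖ ^ 2 + G) ≤ Ctr ^ 2 * (CP ^ 2 * G + G) := by gcongr
  calc _ ≤ CP ^ 2 * G + G + Ctr ^ 2 * (CP ^ 2 * G + G) := by linarith
    _ = G * M := by rw [hM]; ring

/-- The resolvent operator built from solutions of the variational equation. -/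
theorem exists_isInverseQ (hΩ : IsBoundedC1Domain Ω) (ha : ∀ l, IsC1Closure Ω (a l))
    (h : BoundedCoef Ω a b) {δ : ℝ} (hδ : 0 < δ)
    (hco : ∀ x ∈ meanZeroH1 Ω, δ * ‖x‖ ^ 2 ≤ robinForm h x x) {S : ℝ → V Ω →L[ℝ] GraphSpace Ω}
    (hS : ∀ t F, IsVarSol (meanZeroH1 Ω) (robinForm h) val t F (S t F)) {s : ℍ[ℝ]}
    (hs : s.re = 0) : ∃ R, IsInverseQ Ω a b s R ∧ ∀ F, R F = val (S ‖s‖ F) := by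
  refine ⟨{ toFun := fun F => val (S ‖s‖ F)
            map_add' := fun F G => by simp
            map_smul' := fun c F => ?_
            cont := by fun_prop }, fun F u => ?_, fun F => rfl⟩
  · have := (hS ‖s‖ (c • F)).unique (isVarSol_op_smul (hS ‖s‖ F) c.unop) hδ hco
    rw [this]
    rfl
  · rw [isWeakSol_iff hΩ ha h hs]
    constructor
    · rintro ⟨x, rfl, hx⟩
      exact congrArg val (hx.unique (hS ‖s‖ F) hδ hco)
    · rintro rfl
      exact ⟨S ‖s‖ F, rfl, hS ‖s‖ F⟩

end WeakSol

/-! ### The operator `T` on `𝓗` -/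

section VecOp

variable {Ω : Set E3} {a : Fin 3 → E3 → ℝ} {b : E3 → ℝ}

/-- The operator `T` in terms of the gradient. -/
def vecOp (h : BoundedCoef Ω a b) : GraphSpace Ω →L[ℝ] V Ω := ∑ l, lmul (h.T l) ∘L grad l

/-- The factor `f` is regular only inside `Ω`, but near a point off the support of `φ` the product
vanishes identically. -/
theorem IsTest.mul_left (hΩ : IsOpen Ω) {f φ : E3 → ℝ} (hf : ContDiffOn ℝ 1 f Ω)
    (hφ : IsTest Ω φ) : IsTest Ω (fun x => f x * φ x) where
  contDiff := by
    refine contDiff_iff_contDiffAt.2 fun x => ?_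
    by_cases hx : x ∈ tsupport φ
    · exact (hf.contDiffAt (hΩ.mem_nhds (hφ.tsupport_subset hx))).mul hφ.contDiff.contDiffAt
    · have h0 : (fun x => f x * φ x) =ᶠ[𝓝 x] fun _ => 0 := by
        filter_upwards [notMem_tsupport_iff_eventuallyEq.1 hx] with y hy
        rw [hy]
        simp
      exact contDiffAt_const.congr_of_eventuallyEq h0
  hasCompactSupport := hφ.hasCompactSupport.mul_left
  tsupport_subset := (closure_mono (Function.support_mul_subset_right f φ)).trans hφ.tsupport_subset

/-- The fundamental lemma of the calculus of variations; it identifies the value chosen in `opT`. -/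
theorem IsVecOp.unique [IsFiniteMeasure (vol Ω)] (hΩ : IsOpen Ω) {v w w' : V Ω}
    (h : IsVecOp Ω a v w) (h' : IsVecOp Ω a v w') : w = w' := by
  rw [← sub_eq_zero]
  set f := w - w'
  have hf : Integrable f (vol Ω) := (Lp.memLp f).integrable one_le_two
  have h0 : ∀ᵐ x ∂(vol Ω), x ∈ Ω → f x = 0 := by
    refine hΩ.ae_eq_zero_of_integral_contDiff_smul_eq_zero
      (hf.locallyIntegrable.locallyIntegrableOn _) fun φ hφ hc hs => ?_
    have hT : IsTest Ω φ := ⟨hφ.of_le (by exact_mod_cast le_top), hc, hs⟩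
    have h1 := h φ hT
    rw [← h' φ hT, ← testInt_apply hT.memLp, ← testInt_apply hT.memLp] at h1
    rw [← testInt_apply hT.memLp, map_sub, h1, sub_self]
  refine Lp.ext ?_
  filter_upwards [h0, ae_restrict_mem hΩ.measurableSet, Lp.coeFn_zero ℍ[ℝ] 2 (vol Ω)]
    with x h1 h2 h3
  rw [h1 h2, h3, Pi.zero_apply]

variable [IsFiniteMeasure (vol Ω)]

/-- The weak derivative is tested against `a_l φ`, which is again a test function. -/
theorem isVecOp_val (hΩ : IsBoundedC1Domain Ω) (ha : ∀ l, IsC1Closure Ω (a l))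
    (h : BoundedCoef Ω a b) {x : GraphSpace Ω} (hx : x ∈ meanZeroH1 Ω) :
    IsVecOp Ω a (val x) (vecOp h x) := by
  intro φ hφ
  have hw := ((mem_meanZeroH1 x).1 hx).isH1
  rw [← testInt_apply hφ.memLp]
  simp only [vecOp, sum_apply, ContinuousLinearMap.comp_apply, map_sum, ← Finset.sum_neg_distrib]
  refine Finset.sum_congr rfl fun l _ => ?_
  have hψ := hφ.mul_left hΩ.isOpen (ha l).contDiffOn
  have i1 : Integrable (fun z => pd l (fun y => a l y * φ y) z • val x z) (vol Ω) :=
    memLp_one_iff_integrable.1 (hw.memLp.smul (hψ.memLp_pd l))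
  have i2 : Integrable (fun z => (a l z * φ z) • grad l x z) (vol Ω) :=
    memLp_one_iff_integrable.1 ((hw.memLp_deriv l).smul hψ.memLp)
  simp_rw [← mul_smul_comm]
  rw [integral_const_mul_of_integrable i1, ← mul_neg, ← hw.weak_deriv l _ hψ,
    ← integral_const_mul_of_integrable i2, testInt_apply]
  refine integral_congr_ae ?_
  filter_upwards [lmul_ae (h.T l) (grad l x)] with z hz
  rw [hz, coefT, smul_mul_assoc, smul_smul, mul_smul_comm, mul_comm (φ z)]

theorem opT_val (hΩ : IsBoundedC1Domain Ω) (ha : ∀ l, IsC1Closure Ω (a l))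
    (h : BoundedCoef Ω a b) {x : GraphSpace Ω} (hx : x ∈ meanZeroH1 Ω) :
    opT Ω a (val x) = vecOp h x := by
  have hex : ∃ w, IsVecOp Ω a (val x) w := ⟨_, isVecOp_val hΩ ha h hx⟩
  rw [opT, dif_pos hex]
  exact hex.choose_spec.unique hΩ.isOpen (isVecOp_val hΩ ha h hx)

end VecOp

/-! ### Integrability on the line -/

section Decay

variable {Y : Type*} [NormedAddCommGroup Y]

theorem integrableOn_Ioi_of_rpow_bounds {f : ℝ → Y} {α M : ℝ} (hα : 0 < α) (hα1 : α < 1)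
    (hf : ContinuousOn f (Set.Ioi 0)) (h0 : ∀ t, 0 < t → t ≤ 1 → ‖f t‖ ≤ M * t ^ (α - 1))
    (h1 : ∀ t, 1 < t → ‖f t‖ ≤ M * t ^ (α - 2)) : IntegrableOn f (Set.Ioi 0) := by
  rw [← Set.Ioc_union_Ioi_eq_Ioi zero_le_one]
  refine IntegrableOn.union ?_ ?_
  · have hi : IntegrableOn (fun t : ℝ => M * t ^ (α - 1)) (Set.Ioc 0 1) :=
      ((intervalIntegrable_iff_integrableOn_Ioc_of_le zero_le_one).1
        (intervalIntegral.intervalIntegrable_rpow' (by linarith))).const_mul M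
    refine hi.mono' ((hf.mono fun t ht => ht.1).aestronglyMeasurable measurableSet_Ioc) ?_
    filter_upwards [ae_restrict_mem measurableSet_Ioc] with t ht
    exact h0 t ht.1 ht.2
  · have hi : IntegrableOn (fun t : ℝ => M * t ^ (α - 2)) (Set.Ioi 1) :=
      (integrableOn_Ioi_rpow_of_lt (by linarith) one_pos).const_mul M
    refine hi.mono' ((hf.mono (Set.Ioi_subset_Ioi zero_le_one)).aestronglyMeasurable
      measurableSet_Ioi) ?_
    filter_upwards [ae_restrict_mem measurableSet_Ioi] with t ht
    exact h1 t ht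

/-- The half lines are treated separately by reflection; the point `0`, where the power is singular,
is a null set. -/
theorem integrable_of_rpow_bounds {f : ℝ → Y} {α M : ℝ} (hα : 0 < α) (hα1 : α < 1)
    (hf : ContinuousOn f {0}ᶜ) (h0 : ∀ t, t ≠ 0 → |t| ≤ 1 → ‖f t‖ ≤ M * |t| ^ (α - 1))
    (h1 : ∀ t, 1 < |t| → ‖f t‖ ≤ M * |t| ^ (α - 2)) : Integrable f := by
  have hpos : IntegrableOn f (Set.Ioi 0) := by
    refine integrableOn_Ioi_of_rpow_bounds (M := M) hα hα1 (hf.mono fun t ht => ne_of_gt ht)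
      (fun t ht ht1 => ?_) fun t ht => ?_
    · simpa [abs_of_pos ht] using h0 t ht.ne' (by rwa [abs_of_pos ht])
    · have := one_pos.trans ht
      simpa [abs_of_pos this] using h1 t (by rwa [abs_of_pos this])
  have hneg : IntegrableOn (fun t => f (-t)) (Set.Ioi 0) := by
    refine integrableOn_Ioi_of_rpow_bounds (M := M) hα hα1
      (hf.comp continuous_neg.continuousOn fun t ht => neg_ne_zero.2 (ne_of_gt ht))
      (fun t ht ht1 => ?_) fun t ht => ?_
    · simpa [abs_of_pos ht] using h0 (-t) (neg_ne_zero.2 ht.ne') (by rwa [abs_neg, abs_of_pos ht])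
    · have := one_pos.trans ht
      simpa [abs_of_pos this] using h1 (-t) (by rwa [abs_neg, abs_of_pos this])
  have hneg' : IntegrableOn f (Set.Iio 0) := by simpa using hneg.comp_neg
  rw [← integrableOn_univ, ← Set.Iic_union_Ioi (a := (0 : ℝ))]
  exact IntegrableOn.union (by rwa [integrableOn_Iic_iff_integrableOn_Iio]) hpos

end Decay

/-! ### Powers of quaternions -/

theorem norm_qpow_le (s : ℍ[ℝ]) (β : ℝ) : ‖qpow s β‖ ≤ 2 * ‖s‖ ^ β := by
  rw [qpow, norm_smul, Real.norm_of_nonneg (by positivity), mul_comm]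
  refine mul_le_mul_of_nonneg_right ((norm_add_le _ _).trans ?_) (by positivity)
  have h1 := Real.abs_cos_le_one (β * Real.arccos (s.re / ‖s‖))
  have h2 := Real.abs_sin_le_one (β * Real.arccos (s.re / ‖s‖))
  have h3 : ‖(Real.sin (β * Real.arccos (s.re / ‖s‖)) / ‖s.im‖) • s.im‖ ≤ 1 := by
    rw [norm_smul, norm_div, norm_norm, Real.norm_eq_abs, div_mul_eq_mul_div, mul_div_assoc]
    -- The bound `div_self_le_one` also covers `s.im = 0`, where the quotient is `0`.
    exact mul_le_one₀ h2 (by positivity) (div_self_le_one _)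
  rw [Quaternion.norm_coe, Real.norm_eq_abs]
  linarith

theorem im_neg_smul {I : ℍ[ℝ]} (hI : I.re = 0) (t : ℝ) : (-(t • I)).im = -(t • I) := by
  ext <;> simp [hI]

theorem norm_neg_smul_unit {I : ℍ[ℝ]} (hI : ‖I‖ = 1) (t : ℝ) : ‖-(t • I)‖ = |t| := by
  rw [norm_neg, norm_smul, hI, mul_one, Real.norm_eq_abs]

/-- On the imaginary axis the argument is the constant `arccos 0`, so only `|t|^β` and `t / |t|`
vary. -/
theorem continuousOn_qpow_neg_smul {I : ℍ[ℝ]} (hI : I.re = 0) (hI1 : ‖I‖ = 1) (β : ℝ) :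
    ContinuousOn (fun t : ℝ => qpow (-(t • I)) β) {0}ᶜ := by
  have hre : ∀ t : ℝ, (-(t • I)).re = 0 := fun t => by simp [hI]
  simp only [qpow, hre, im_neg_smul hI, norm_neg_smul_unit hI1, zero_div]
  have habs : ContinuousOn (fun t : ℝ => |t|) {0}ᶜ := continuous_abs.continuousOn
  have hne : ∀ t ∈ ({0}ᶜ : Set ℝ), |t| ≠ 0 := fun t ht => abs_ne_zero.2 ht
  exact (habs.rpow_const fun t ht => Or.inl (hne t ht)).smul
    (continuousOn_const.add ((continuousOn_const.div habs hne).smul (by fun_prop)))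

/-! ### Integrals of solution operators -/

section SolutionIntegrals

variable {X Y : Type*} [NormedAddCommGroup X] [InnerProductSpace ℝ X]
  [NormedAddCommGroup Y] [InnerProductSpace ℝ Y] [Module ℍ[ℝ] Y] [IsBoundedSMul ℍ[ℝ] Y]
  {H : Submodule ℝ X} {B : X →L[ℝ] X →L[ℝ] ℝ} {P : X →L[ℝ] Y} {δ : ℝ} {S : ℝ → Y →L[ℝ] X}
  {α N : ℝ} {c : ℝ → ℍ[ℝ]} {F : ℝ → Y}

theorem continuousOn_smul_solution (hSc : Continuous S) (hc : ContinuousOn c {0}ᶜ)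
    (hFc : ContinuousOn F {0}ᶜ) (L : X →L[ℝ] Y) :
    ContinuousOn (fun t => c t • L (S |t| (F t))) {0}ᶜ :=
  hc.smul (L.continuous.comp_continuousOn
    ((hSc.comp continuous_abs).continuousOn.clm_apply hFc))

theorem rpow_sub_one_div {t : ℝ} (ht : 0 < t) (α : ℝ) : t ^ (α - 1) / t = t ^ (α - 2) := by
  rw [← Real.rpow_sub_one ht.ne']
  ring_nf

/-- Serves the term `T Q_s(T)⁻¹`, with `L = vecOp h`. The bound uniform in `t` is used for `|t| ≤
1`, the `1/|t|` decay beyond. -/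
theorem integrable_smul_solution (hδ : 0 < δ) (hB : ∀ x ∈ H, δ * ‖x‖ ^ 2 ≤ B x x)
    (hSc : Continuous S) (hS : ∀ t F, IsVarSol H B P t F (S t F)) (hα : 0 < α) (hα1 : α < 1)
    (hc : ContinuousOn c {0}ᶜ) (hFc : ContinuousOn F {0}ᶜ)
    (hF : ∀ t, t ≠ 0 → ‖c t‖ * ‖F t‖ ≤ N * |t| ^ (α - 1)) (L : X →L[ℝ] Y) :
    Integrable fun t => c t • L (S |t| (F t)) := by
  have hn : ∀ t, ‖c t • L (S |t| (F t))‖ ≤ ‖c t‖ * (‖L‖ * ‖S |t| (F t)‖) := fun t =>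
    (norm_smul_le _ _).trans (by gcongr; exact L.le_opNorm _)
  set K := δ⁻¹ * ‖P‖ with hK
  set k := (√δ)⁻¹ with hk
  have hK0 : 0 ≤ K := by positivity
  have hk0 : 0 ≤ k := by positivity
  have hN : ∀ t, t ≠ 0 → 0 ≤ N * |t| ^ (α - 1) := fun t ht => le_trans (by positivity) (hF t ht)
  refine integrable_of_rpow_bounds (M := ‖L‖ * (K + k) * N) hα hα1
    (continuousOn_smul_solution hSc hc hFc L) (fun t ht _ => ?_) fun t ht => ?_
  · calc _ ≤ ‖c t‖ * (‖L‖ * (K * ‖F t‖)) := (hn t).trans (by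
          gcongr; exact (hS _ _).norm_le hδ hB)
      _ = ‖L‖ * K * (‖c t‖ * ‖F t‖) := by ring
      _ ≤ ‖L‖ * K * (N * |t| ^ (α - 1)) := mul_le_mul_of_nonneg_left (hF t ht) (by positivity)
      _ ≤ ‖L‖ * (K + k) * (N * |t| ^ (α - 1)) := by
        have := hN t ht
        gcongr
        linarith
      _ = _ := by ring
  · have ht0 : 0 < |t| := one_pos.trans ht
    have htne : t ≠ 0 := abs_pos.1 ht0
    have h1 : ‖S |t| (F t)‖ ≤ k * ‖F t‖ / |t| := by
      rw [le_div_iff₀ ht0, mul_comm]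
      simpa using (hS |t| (F t)).abs_mul_norm_le hδ hB
    calc _ ≤ ‖c t‖ * (‖L‖ * (k * ‖F t‖ / |t|)) := (hn t).trans (by gcongr)
      _ = ‖L‖ * k * ((‖c t‖ * ‖F t‖) / |t|) := by ring
      _ ≤ ‖L‖ * k * ((N * |t| ^ (α - 1)) / |t|) :=
        mul_le_mul_of_nonneg_left (div_le_div_of_nonneg_right (hF t htne) ht0.le) (by positivity)
      _ ≤ ‖L‖ * (K + k) * ((N * |t| ^ (α - 1)) / |t|) := by
        have := div_nonneg (hN t htne) ht0.le
        gcongr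
        linarith
      _ = _ := by rw [mul_div_assoc, rpow_sub_one_div ht0]; ring

/-- Serves the term with `s̄`, whose extra factor `|t|` is offset by the quadratic decay of the `L²`
norm. -/
theorem integrable_smul_solution_val (hδ : 0 < δ) (hB : ∀ x ∈ H, δ * ‖x‖ ^ 2 ≤ B x x)
    (hSc : Continuous S) (hS : ∀ t F, IsVarSol H B P t F (S t F)) (hα : 0 < α) (hα1 : α < 1)
    (hc : ContinuousOn c {0}ᶜ) (hFc : ContinuousOn F {0}ᶜ)
    (hF : ∀ t, t ≠ 0 → ‖c t‖ * ‖F t‖ ≤ N * |t| ^ (α - 1) * |t|) :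
    Integrable fun t => c t • P (S |t| (F t)) := by
  have hn : ∀ t, ‖c t • P (S |t| (F t))‖ ≤ ‖c t‖ * ‖P (S |t| (F t))‖ := fun t => norm_smul_le _ _
  set K := δ⁻¹ * ‖P‖ with hK
  have hK0 : 0 ≤ K := by positivity
  have hN : ∀ t, t ≠ 0 → 0 ≤ N * |t| ^ (α - 1) := fun t ht =>
    nonneg_of_mul_nonneg_left (le_trans (by positivity) (hF t ht)) (abs_pos.2 ht)
  -- `‖P‖ * K` is needed for `|t| ≤ 1`, and `1` is the constant of `sq_mul_norm_le` for `|t| > 1`.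
  refine integrable_of_rpow_bounds (M := (‖P‖ * K + 1) * N) hα hα1
    (continuousOn_smul_solution hSc hc hFc P) (fun t ht ht1 => ?_) fun t ht => ?_
  · have h0 := hN t ht
    calc _ ≤ ‖c t‖ * (‖P‖ * (K * ‖F t‖)) := (hn t).trans (by
          gcongr
          exact (P.le_opNorm _).trans (by gcongr; exact (hS _ _).norm_le hδ hB))
      _ = ‖P‖ * K * (‖c t‖ * ‖F t‖) := by ring
      _ ≤ ‖P‖ * K * (N * |t| ^ (α - 1) * 1) :=
        mul_le_mul_of_nonneg_left ((hF t ht).trans (by gcongr)) (by positivity)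
      _ ≤ (‖P‖ * K + 1) * (N * |t| ^ (α - 1) * 1) := by
        gcongr
        linarith
      _ = _ := by ring
  · have ht0 : 0 < |t| := one_pos.trans ht
    have htne : t ≠ 0 := abs_pos.1 ht0
    have h1 : ‖P (S |t| (F t))‖ ≤ ‖F t‖ / |t| ^ 2 := by
      rw [le_div_iff₀ (by positivity), mul_comm]
      exact (hS |t| (F t)).sq_mul_norm_le hδ hB
    calc _ ≤ ‖c t‖ * (‖F t‖ / |t| ^ 2) := (hn t).trans (by gcongr)
      _ = (‖c t‖ * ‖F t‖) / |t| ^ 2 := by ring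
      _ ≤ (N * |t| ^ (α - 1) * |t|) / |t| ^ 2 :=
        div_le_div_of_nonneg_right (hF t htne) (by positivity)
      _ = 1 * ((N * |t| ^ (α - 1)) / |t|) := by field_simp
      _ ≤ (‖P‖ * K + 1) * ((N * |t| ^ (α - 1)) / |t|) := by
        have := div_nonneg (hN t htne) ht0.le
        gcongr
        linarith [show 0 ≤ ‖P‖ * K by positivity]
      _ = _ := by rw [mul_div_assoc, rpow_sub_one_div ht0]; ring

end SolutionIntegrals

/-! ### The integrands of the fractional powers -/

section Integrands

variable {Ω : Set E3} {a : Fin 3 → E3 → ℝ} {b : E3 → ℝ} [IsFiniteMeasure (vol Ω)]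
  {h : BoundedCoef Ω a b} {δ : ℝ} {S : ℝ → V Ω →L[ℝ] GraphSpace Ω} {I : ℍ[ℝ]} {α : ℝ}

theorem opT_solution (hΩ : IsBoundedC1Domain Ω) (ha : ∀ l, IsC1Closure Ω (a l))
    (hS : ∀ t F, IsVarSol (meanZeroH1 Ω) (robinForm h) val t F (S t F)) (t : ℝ) (F : V Ω) :
    opT Ω a (val (S t F)) = vecOp h (S t F) :=
  opT_val hΩ ha h (hS t F).1

theorem norm_neg_mul_inv (hI1 : ‖I‖ = 1) : ‖-I * I⁻¹‖ = 1 := by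
  rw [norm_mul, norm_neg, norm_inv, hI1, inv_one, mul_one]

theorem norm_qpow_neg_smul_le (hI1 : ‖I‖ = 1) (t β : ℝ) :
    ‖qpow (-(t • I)) β‖ ≤ 2 * |t| ^ β := by
  simpa [norm_smul, hI1] using norm_qpow_le (-(t • I)) β

theorem continuous_star_neg_smul (I : ℍ[ℝ]) : Continuous fun t : ℝ => star (-(t • I)) :=
  starCLM.continuous.comp (by fun_prop)

theorem norm_star_neg_smul (hI1 : ‖I‖ = 1) (t : ℝ) : ‖star (-(t • I))‖ = |t| := by
  rw [norm_star, norm_neg_smul_unit hI1]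

/-- Here `s^(α-1)` and `s̄` act on the datum, before the solution operator. -/
theorem integrable_integrandL (hΩ : IsBoundedC1Domain Ω) (ha : ∀ l, IsC1Closure Ω (a l))
    (hδ : 0 < δ) (hco : ∀ x ∈ meanZeroH1 Ω, δ * ‖x‖ ^ 2 ≤ robinForm h x x) (hSc : Continuous S)
    (hS : ∀ t F, IsVarSol (meanZeroH1 Ω) (robinForm h) val t F (S t F))
    (hres : ∀ s : ℍ[ℝ], s.re = 0 → ∀ F, pseudoRes Ω a b s F = val (S ‖s‖ F))
    (hI : I.re = 0) (hI1 : ‖I‖ = 1) (hα : 0 < α) (hα1 : α < 1) (v : V Ω) :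
    Integrable (integrandL Ω a b I α v) := by
  have hre : ∀ t : ℝ, (-(t • I)).re = 0 := fun t => by simp [hI]
  set F : ℝ → V Ω := fun t => (-I * I⁻¹ * qpow (-(t • I)) (α - 1)) • opT Ω a v with hFdef
  have hFc : ContinuousOn F {0}ᶜ :=
    (continuousOn_const.mul (continuousOn_qpow_neg_smul hI hI1 _)).smul continuousOn_const
  have hF : ∀ t, ‖F t‖ ≤ 2 * ‖opT Ω a v‖ * |t| ^ (α - 1) := fun t => by
    refine (norm_smul_le _ _).trans ?_
    rw [norm_mul, norm_neg_mul_inv hI1, one_mul]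
    nlinarith [norm_qpow_neg_smul_le hI1 t (α - 1), norm_nonneg (opT Ω a v)]
  have h1 := integrable_smul_solution_val (c := fun _ => 1) (F := fun t => star (-(t • I)) • F t)
    (N := 2 * ‖opT Ω a v‖) hδ hco hSc hS hα hα1 continuousOn_const
    ((continuous_star_neg_smul I).continuousOn.smul hFc) fun t _ => by
      rw [norm_one, one_mul, mul_comm _ |t|]
      refine (norm_smul_le _ _).trans ?_
      rw [norm_star_neg_smul hI1]
      gcongr
      exact hF t
  have h2 := integrable_smul_solution (c := fun _ => 1) (F := F)
    (N := 2 * ‖opT Ω a v‖) hδ hco hSc hS hα hα1 continuousOn_const hFc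
    (fun t _ => by rw [norm_one, one_mul]; exact hF t) (vecOp h)
  refine ((h1.sub h2).smul (2 * Real.pi)⁻¹).congr (Eventually.of_forall fun t => ?_)
  simp only [integrandL, leftSRes, hres _ (hre t), norm_neg_smul_unit hI1,
    opT_solution hΩ ha hS, Pi.smul_apply, Pi.sub_apply, one_smul, hFdef]

/-- Here the scalars act after the solution operator. It is only right linear, so they cannot be
moved onto the datum. -/
theorem integrable_integrandR (hΩ : IsBoundedC1Domain Ω) (ha : ∀ l, IsC1Closure Ω (a l))
    (hδ : 0 < δ) (hco : ∀ x ∈ meanZeroH1 Ω, δ * ‖x‖ ^ 2 ≤ robinForm h x x) (hSc : Continuous S)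
    (hS : ∀ t F, IsVarSol (meanZeroH1 Ω) (robinForm h) val t F (S t F))
    (hres : ∀ s : ℍ[ℝ], s.re = 0 → ∀ F, pseudoRes Ω a b s F = val (S ‖s‖ F))
    (hI : I.re = 0) (hI1 : ‖I‖ = 1) (hα : 0 < α) (hα1 : α < 1) (v : V Ω) :
    Integrable (integrandR Ω a b I α v) := by
  have hre : ∀ t : ℝ, (-(t • I)).re = 0 := fun t => by simp [hI]
  set c : ℝ → ℍ[ℝ] := fun t => qpow (-(t • I)) (α - 1) * (-I * I⁻¹) with hcdef
  set w := opT Ω a v with hw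
  have hc : ContinuousOn c {0}ᶜ := (continuousOn_qpow_neg_smul hI hI1 _).mul continuousOn_const
  have hcn : ∀ t, ‖c t‖ ≤ 2 * |t| ^ (α - 1) := fun t => by
    rw [hcdef]
    dsimp only
    rw [norm_mul, norm_neg_mul_inv hI1, mul_one]
    exact norm_qpow_neg_smul_le hI1 t _
  have h1 := integrable_smul_solution_val (c := fun t => c t * star (-(t • I))) (F := fun _ => w)
    (N := 2 * ‖w‖) hδ hco hSc hS hα hα1 (hc.mul (continuous_star_neg_smul I).continuousOn)
    continuousOn_const fun t _ => by
      rw [norm_mul, norm_star_neg_smul hI1]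
      calc _ ≤ 2 * |t| ^ (α - 1) * |t| * ‖w‖ := by gcongr; exact hcn t
        _ = _ := by ring
  have h2 := integrable_smul_solution (c := c) (F := fun _ => w)
    (N := 2 * ‖w‖) hδ hco hSc hS hα hα1 hc continuousOn_const
    (fun t _ => by
      calc _ ≤ 2 * |t| ^ (α - 1) * ‖w‖ := by gcongr; exact hcn t
        _ = _ := by ring) (vecOp h)
  refine ((h1.sub h2).smul (2 * Real.pi)⁻¹).congr (Eventually.of_forall fun t => ?_)
  simp only [integrandR, rightSRes, hres _ (hre t), norm_neg_smul_unit hI1,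
    opT_solution hΩ ha hS, Pi.smul_apply, Pi.sub_apply, hcdef, neg_sub, smul_sub, mul_smul, ← hw]

end Integrands

end RobinFractional

end

open RobinFractional in
theorem theorem5p6 (Ω : Set E3) (hΩ : IsBoundedC1Domain Ω)
    (b : E3 → ℝ) (hb : ContinuousOn b (frontier Ω))
    (a : Fin 3 → E3 → ℝ) (ha : ∀ l, IsC1Closure Ω (a l))
    (Ctr CP : ℝ) (hCtr : IsTraceConstant Ω Ctr) (hCP : IsPoincareWirtingerConstant Ω CP)
    (hcond : 0 < constT Ω a - constT' Ω a * CP - constK Ω b Ctr * (1 + CP ^ 2))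
    (hCT : 0 < constT Ω a) :
    (∀ s : ℍ[ℝ], s.re = 0 → s ≠ 0 →
      s ∈ sResolventSet Ω a b ∧ ∀ F : V Ω, pseudoRes Ω a b s F ∈ domT Ω a) ∧
    (∀ I : ℍ[ℝ], I.re = 0 → ‖I‖ = 1 → ∀ α : ℝ, 0 < α → α < 1 → ∀ v ∈ domT Ω a,
      Integrable (integrandL Ω a b I α v) ∧ Integrable (integrandR Ω a b I α v)) := by
  have := hΩ.isFiniteMeasure
  have h := boundedCoef hΩ hb ha
  obtain ⟨δ, hδ, hco⟩ := robinForm_coercive hΩ hb ha hCtr hCP hcond h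
  obtain ⟨S, hSc, hS⟩ := exists_continuous_varSol (P := val) isClosed_meanZeroH1 hδ hco
  -- A single family `S` serves all imaginary directions, since the equation involves only `‖s‖`.
  have hres : ∀ s : ℍ[ℝ], s.re = 0 → ∀ F, pseudoRes Ω a b s F = val (S ‖s‖ F) := fun s hs F => by
    obtain ⟨R, hR, hRS⟩ := exists_isInverseQ hΩ ha h hδ hco hS hs
    rw [pseudoRes_eq hR, hRS]
  refine ⟨fun s hs _ => ⟨?_, fun F => ?_⟩, fun I hI hI1 α hα hα1 v _ => ⟨?_, ?_⟩⟩
  · obtain ⟨R, hR, -⟩ := exists_isInverseQ hΩ ha h hδ hco hS hs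
    exact ⟨R, hR⟩
  · rw [hres s hs]
    exact ⟨_, isVecOp_val hΩ ha h (hS _ F).1⟩
  · exact integrable_integrandL hΩ ha hδ hco hSc hS hres hI hI1 hα hα1 v
  · exact integrable_integrandR hΩ ha hδ hco hSc hS hres hI hI1 hα hα1 v
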